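/- **Setting.** A network is an undirected connected graph on $N\ge 1$ non-Byzantine agents and $B\ge 0$ Byzantine agents, whose subgraph on the non-Byzantine agents is connected too. Non-Byzantine agent $n$ has a data distribution $\mathcal D_n$ and a dataset $S_n=\{\xi_{n,1},\dots,\xi_{n,Z}\}$, $Z\ge 1$, drawn i.i.d. from $\mathcal D_n$; all samples are independent. For a loss $f(x;\xi)$, $x\in\mathbb R^d$, put $F(x)=\frac1N\sum_n\mathbb E_{\xi\sim\mathcal D_n}f(x;\xi)$, $F_{S_n}(x)=\frac1Z\sum_z f(x;\xi_{n,z})$, $F_S=\frac1N\sum_n F_{S_n}$, and let $x_S^*$ be the minimizer of $F_S$ ($\mathbb E\|x_S^*\|^2<\infty$). *Algorithm (Byzantine-resilient DSGD).* All non-Byzantine agents start at the same $x^0$. At time $k=0,1,\dots$ each of them draws $\xi_n^k$ uniformly from $S_n$, independently of the other agents and of the past, computes $x_n^{k+1/2}=x_n^k-\alpha^k\nabla f(x_n^k;\xi_n^k)$, sends it to all its neighbours, and sets $x_n^{k+1}=\mathcal A_n(x_n^{k+1/2},\{\text{messages received from all neighbours}\})$. Byzantine agents send arbitrary messages, which may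 depend on all data, on all draws up to and including time $k$, and on further randomness, but not on later draws. Let $\bar x^k=\frac1N\sum_n x_n^k$. *Aggregation.* The aggregation rules $\mathcal A_n$ have a virtual mixing matrix $W=[w_{nm}]\in[0,1]^{N\times N}$, with rows summing to $1$ and $w_{nm}=0$ unless $m\in\mathcal N_n\cup\{n\}$ ($\mathcal N_n$: the non-Byzantine neighbours of $n$), and a contraction constant $\rho\ge0$: for all models $x_m$ of the non-Byzantine agents and all Byzantine messages, with $\hat x_n=\sum_m w_{nm}x_m$, the output of $\mathcal A_n$ is within $\rho\max_{m\in\mathcal N_n\cup\{n\}}\|x_m-\hat x_n\|$ of $\hat x_n$. Put $\lambda=1-\|(I-\frac1N\mathbf 1\mathbf 1^\top)W\|^2$ (spectral norm) and $\chi^2=\frac1N\|W^\top\mathbf 1-\mathbf 1\|^2$. *Assumptions.* For every $\xi$, $f(\cdot;\xi)$ is differentiable, $\mu$-strongly convex and has an $L$-Lipschitz gradient ($\mu,L>0$); and, almost surely in the dataset, for all $x$ and $n$, $\frac1Z\sum_z\|\nabla f(x;\xi_{n,z})-\nabla F_{S_n}(x)\|^2\le\sigma^2$ and $\frac1N\sum_m\|\nabla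 F_{S_m}(x)-\nabla F_S(x)\|^2\le\delta^2$. **Theorem.** Let $0<\lambda\le1$ and $\rho<\frac{\lambda}{8\sqrt N}$, and let the step size be $\alpha^k=\frac{2}{\mu(k+k_1)}$ with $k_1$ sufficiently large (larger than a threshold that depends only on $\mu,L,\lambda$). If $k\asymp\mu NZ$, i.e. $a\,\mu NZ\le k\le b\,\mu NZ$ with constants $0<a\le b$, then the generalization error of $\bar x^k$ is finite and $$\mathbb E\big[F(\bar x^k)-F_S(\bar x^k)\big]\le C\left(\frac{\mathbb E\|\bar x^0-x_S^*\|^2}{\mu NZ}+\frac{\sigma^2\,(1+\ln(NZ))}{\mu NZ}+\frac{\delta^2}{\mu NZ}+(4\rho^2N+\chi^2)(\sigma^2+\delta^2)\right),$$ where the constant $C$ depends only on $\mu,L,\lambda,k_1,a,b$ (in particular not on $N,Z,B,d$, the network, the data distributions, the initialization, $\sigma$, $\delta$, $\rho$, $\chi$ or the Byzantine behaviour). -/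

import Mathlib

open MeasureTheory ProbabilityTheory

/-- The space of models `ℝ^d` with its Euclidean norm. -/
abbrev Model (d : ℕ) : Type := EuclideanSpace ℝ (Fin d)

section Loss

variable {d : ℕ} {Ξ : Type*}

/-- Every `f(· ; ξ)` is differentiable and `μ`-strongly convex. -/
def StronglyConvexLoss (f : Model d → Ξ → ℝ) (μ : ℝ) : Prop :=
  ∀ ξ : Ξ, Differentiable ℝ (fun y => f y ξ) ∧
    ∀ x y : Model d,
      f y ξ + inner ℝ (x - y) (gradient (fun u => f u ξ) y) + μ / 2 * ‖x - y‖ ^ 2 ≤ f x ξ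

/-- Every `f(· ; ξ)` has an `L`-Lipschitz gradient. -/
def SmoothLoss (f : Model d → Ξ → ℝ) (L : ℝ) : Prop :=
  ∀ (ξ : Ξ) (x y : Model d),
    ‖gradient (fun u => f u ξ) x - gradient (fun u => f u ξ) y‖ ≤ L * ‖x - y‖

/-- Population loss `F(x) = (1/N) ∑ₙ 𝔼_{ξ ∼ Dₙ} f(x; ξ)`. -/
noncomputable def populationLoss {N : ℕ} [MeasurableSpace Ξ] (f : Model d → Ξ → ℝ)
    (D : Fin N → Measure Ξ) (x : Model d) : ℝ :=
  (1 / (N : ℝ)) * ∑ n, ∫ ξ, f x ξ ∂(D n)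

/-- Local empirical loss `(1/Z) ∑_z f(x; s_z)` of a dataset `s` of `Z` samples. -/
noncomputable def localLoss {Z : ℕ} (f : Model d → Ξ → ℝ) (s : Fin Z → Ξ) (x : Model d) : ℝ :=
  (1 / (Z : ℝ)) * ∑ z, f x (s z)

/-- Global empirical loss: the average of the local empirical losses over the `N` agents. -/
noncomputable def empiricalLoss {N Z : ℕ} (f : Model d → Ξ → ℝ) (S : Fin N → Fin Z → Ξ)
    (x : Model d) : ℝ :=
  (1 / (N : ℝ)) * ∑ n, localLoss f (S n) x

/-- Bounded stochastic gradient noise: at every point, the gradient at a sample drawn uniformly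
from the local dataset of any agent has variance at most `σ²`. -/
def BoundedNoise {N Z : ℕ} (f : Model d → Ξ → ℝ) (S : Fin N → Fin Z → Ξ) (σ : ℝ) : Prop :=
  ∀ (x : Model d) (n : Fin N),
    (1 / (Z : ℝ)) * ∑ z, ‖gradient (fun u => f u (S n z)) x - gradient (localLoss f (S n)) x‖ ^ 2
      ≤ σ ^ 2

/-- Bounded heterogeneity of the local empirical losses. -/
def BoundedHeterogeneity {N Z : ℕ} (f : Model d → Ξ → ℝ) (S : Fin N → Fin Z → Ξ) (δ : ℝ) : Prop :=
  ∀ x : Model d,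
    (1 / (N : ℝ)) * ∑ n, ‖gradient (localLoss f (S n)) x - gradient (empiricalLoss f S) x‖ ^ 2
      ≤ δ ^ 2

end Loss

section Aggregation

variable {N B : ℕ}

/-- An aggregation rule of the non-Byzantine agent `n` in the network `G`, whose vertices are the
`N` non-Byzantine agents `Sum.inl n` and the `B` Byzantine agents `Sum.inr b`: it maps the agent's
own model and the messages of all its neighbours to a new model. -/
abbrev AggregationRule (G : SimpleGraph (Fin N ⊕ Fin B)) (d : ℕ) (n : Fin N) : Type :=
  Model d → (G.neighborSet (Sum.inl n) → Model d) → Model d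

/-- `W` is a virtual mixing matrix and `ρ` a contraction constant of the rules `A`. Here `u m` is
the model of the non-Byzantine agent `m` and `v b` the (arbitrary) message of the Byzantine
agent `b`; the rule of agent `n` only sees those of its neighbours. -/
structure IsVirtualMixing {d : ℕ} (G : SimpleGraph (Fin N ⊕ Fin B))
    (A : (n : Fin N) → AggregationRule G d n) (W : Matrix (Fin N) (Fin N) ℝ) (ρ : ℝ) : Prop where
  weight_mem : ∀ n m, W n m ∈ Set.Icc (0 : ℝ) 1
  weight_eq_zero : ∀ n m, m ≠ n → ¬ G.Adj (Sum.inl n) (Sum.inl m) → W n m = 0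
  row_sum : ∀ n, ∑ m, W n m = 1
  rho_nonneg : 0 ≤ ρ
  contraction : ∀ (n : Fin N) (u : Fin N → Model d) (v : Fin B → Model d),
    ‖A n (u n) (fun m => Sum.elim u v m.1) - ∑ m, W n m • u m‖ ≤
      ρ * ⨆ m : {m : Fin N // m = n ∨ G.Adj (Sum.inl n) (Sum.inl m)},
        ‖u m.1 - ∑ m', W n m' • u m'‖

/-- `λ = 1 - ‖(I - (1/N) 1 1ᵀ) W‖²` with the spectral norm. -/
noncomputable def mixingGap (W : Matrix (Fin N) (Fin N) ℝ) : ℝ :=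
  1 - ‖Matrix.toEuclideanCLM (n := Fin N) (𝕜 := ℝ)
    ((1 - (1 / (N : ℝ)) • Matrix.of (fun _ _ => (1 : ℝ))) * W)‖ ^ 2

/-- `χ² = (1/N) ‖Wᵀ 1 - 1‖²`. -/
noncomputable def chiSq (W : Matrix (Fin N) (Fin N) ℝ) : ℝ :=
  (1 / (N : ℝ)) * ∑ m, (∑ n, W n m - 1) ^ 2

end Aggregation

section Algorithm

variable {N B Z d : ℕ} {Ξ Ω : Type*}

/-- The local model after the gradient step with step size `α`, from the local models `x`, with
the sample number `i n` of agent `n`'s dataset. -/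
noncomputable def halfStep (f : Model d → Ξ → ℝ) (S : Fin N → Fin Z → Ξ) (α : ℝ)
    (i : Fin N → Fin Z) (x : Fin N → Model d) (n : Fin N) : Model d :=
  x n - α • gradient (fun u => f u (S n (i n))) (x n)

/-- Byzantine-resilient DSGD: the local models of the non-Byzantine agents at time `k`, for the
outcome `ω`. `S` is the random dataset, `α` the step sizes, `idx k ω n` the number of the sample
drawn by agent `n` at time `k`, and `byz k b n ω` the message that the Byzantine agent `b` sends to
agent `n` at time `k`. -/
noncomputable def dsgd (f : Model d → Ξ → ℝ) (G : SimpleGraph (Fin N ⊕ Fin B))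
    (A : (n : Fin N) → AggregationRule G d n) (α : ℕ → ℝ) (x₀ : Model d)
    (S : Ω → Fin N → Fin Z → Ξ) (idx : ℕ → Ω → Fin N → Fin Z)
    (byz : ℕ → Fin B → Fin N → Ω → Model d) : ℕ → Ω → Fin N → Model d
  | 0, _, _ => x₀
  | k + 1, ω, n =>
      let h := halfStep f (S ω) (α k) (idx k ω) (dsgd f G A α x₀ S idx byz k ω)
      A n (h n) (fun m => Sum.elim h (fun b => byz k b n ω) m.1)

/-- The average of the `N` local models. -/
noncomputable def meanModel (x : Fin N → Model d) : Model d :=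
  (1 / (N : ℝ)) • ∑ n, x n

/-- The probabilistic setup. The samples of the dataset `S` are independent, those of agent `n`
with law `D n`, and are known at time `0`. At time `k` the agents draw sample numbers uniformly,
independently of each other and of the past `𝓕 k`. The Byzantine messages sent at time `k` are
arbitrary `𝓕 (k + 1)`-measurable: they may depend on the dataset, on all draws up to and including
time `k` and on further randomness, but not on later draws. -/
structure IsByzantineSetup [MeasurableSpace Ξ] {mΩ : MeasurableSpace Ω} (P : Measure Ω)
    (𝓕 : Filtration ℕ mΩ) (D : Fin N → Measure Ξ) (S : Ω → Fin N → Fin Z → Ξ)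
    (idx : ℕ → Ω → Fin N → Fin Z) (byz : ℕ → Fin B → Fin N → Ω → Model d) : Prop where
  data_meas : ∀ n z, Measurable[𝓕 0] (fun ω => S ω n z)
  data_indep : iIndepFun (fun (p : Fin N × Fin Z) ω => S ω p.1 p.2) P
  data_law : ∀ n z, P.map (fun ω => S ω n z) = D n
  idx_meas : ∀ k, Measurable[𝓕 (k + 1)] (idx k)
  idx_uniform : ∀ k (j : Fin N → Fin Z), P {ω | idx k ω = j} = ((Z : ENNReal) ^ N)⁻¹
  idx_indep : ∀ k, Indep (MeasurableSpace.comap (idx k) inferInstance) (𝓕 k) P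
  byz_meas : ∀ k b n, Measurable[𝓕 (k + 1)] (byz k b n)

end Algorithm

/-! Let `y` be the zero of the expected gradient, i.e. the minimizer of the population loss F, and
put g = ∇F_S(y). Smoothness at `y` bounds F(u) from above, convexity at `y` bounds F_S(u) from
below, and F(y) - F_S(y) has mean zero because `y` is deterministic. Strong convexity gives ‖x_S* -
y‖ ≤ ‖g‖ / μ. Hence the expected generalization error of any data-dependent u is at most a constant
times E‖u - x_S*‖² + E‖g‖² (`generalizationError_le`). The sensitivity of the trajectory to single
samples plays no role, and the logarithm in the statement is only slack.

Statistical term. g is the average of N Z independent vectors whose sum has mean zero, so E‖g‖² is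
at most 1/(N Z) times their mean second moment. Noise and heterogeneity bound that moment by σ² + δ²
+ E‖g‖², and the inequality is solved for E‖g‖² when N Z ≥ 2 (`integral_empiricalGrad_sq_le`). For N
Z = 1 it is void, and the initial distance to x_S* takes over.

Optimization term, with m = k + k₁ and step size 2/(μ m). A gradient step inflates the dispersion of
the local models by at most 1 + λ/8 and adds O((σ² + δ²)/m²); aggregation contracts it by 1 - λ/4.
The dispersion is therefore O((σ² + δ²)/m²) (`integral_dispersion_rate`). The average model is
contracted by the gradient step, up to sampling noise of order σ²/m², and then displaced by
aggregation by a vector of squared length at most 2(4ρ²N + χ²) times the dispersion. This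
displacement may be correlated with everything, so it is paid for by Young's inequality with
parameter of order 1/m. The resulting error of order 1/m per step, against a contraction 1 - 3/(2m),
leaves the constant floor (`integral_meanModel_rate`).

Unbiasedness of the draws is used only before aggregation. The aggregation estimates hold for each
outcome and all messages, so Byzantine knowledge of the current draws does no harm. -/

/-! ### Averages over agents and dispersion around them. -/

section MeanModel

variable {d N : ℕ}

/-- Young's inequality for the square of the norm of a sum. -/
lemma norm_add_sq_le_young {E : Type*} [SeminormedAddCommGroup E] (a b : E) {η : ℝ} (hη : 0 < η) :
    ‖a + b‖ ^ 2 ≤ (1 + η) * ‖a‖ ^ 2 + (1 + 1 / η) * ‖b‖ ^ 2 := by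
  have h1 : ‖a + b‖ ^ 2 ≤ (‖a‖ + ‖b‖) ^ 2 := by gcongr; exact norm_add_le a b
  have h2 : (1 + η) * ‖a‖ ^ 2 + (1 + 1 / η) * ‖b‖ ^ 2 - (‖a‖ + ‖b‖) ^ 2
      = (η * ‖a‖ - ‖b‖) ^ 2 / η := by
    field_simp; ring
  have h3 : 0 ≤ (η * ‖a‖ - ‖b‖) ^ 2 / η := by positivity
  linarith

lemma norm_add_sq_le_two {E : Type*} [SeminormedAddCommGroup E] (a b : E) :
    ‖a + b‖ ^ 2 ≤ 2 * ‖a‖ ^ 2 + 2 * ‖b‖ ^ 2 := by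
  have := norm_add_sq_le_young a b one_pos
  norm_num at this
  exact this

lemma meanModel_add (u v : Fin N → Model d) :
    meanModel (fun n => u n + v n) = meanModel u + meanModel v := by
  simp [meanModel, Finset.sum_add_distrib]

lemma meanModel_sub (u v : Fin N → Model d) :
    meanModel (fun n => u n - v n) = meanModel u - meanModel v := by
  simp [meanModel, Finset.sum_sub_distrib, smul_sub]

lemma meanModel_smul (c : ℝ) (u : Fin N → Model d) :
    meanModel (fun n => c • u n) = c • meanModel u := by
  simp [meanModel, ← Finset.smul_sum, smul_comm c]

lemma meanModel_const (hN : 0 < N) (c : Model d) : meanModel (fun _ : Fin N => c) = c := by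
  have : (N : ℝ) ≠ 0 := by positivity
  simp [meanModel, ← Nat.cast_smul_eq_nsmul ℝ, smul_smul, this]

lemma inner_meanModel_left (u : Fin N → Model d) (v : Model d) :
    inner ℝ (meanModel u) v = (1 / (N : ℝ)) * ∑ n, inner ℝ (u n) v := by
  simp [meanModel, inner_smul_left, sum_inner]

/-- The mean squared distance of the models `u` to their average. -/
noncomputable def dispersion (u : Fin N → Model d) : ℝ :=
  (1 / (N : ℝ)) * ∑ n, ‖u n - meanModel u‖ ^ 2

lemma dispersion_nonneg (u : Fin N → Model d) : 0 ≤ dispersion u := by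
  unfold dispersion; positivity

/-- The bias-variance decomposition of the mean squared distance to `c`. -/
lemma mean_norm_sub_sq (hN : 0 < N) (u : Fin N → Model d) (c : Model d) :
    (1 / (N : ℝ)) * ∑ n, ‖u n - c‖ ^ 2 = dispersion u + ‖meanModel u - c‖ ^ 2 := by
  have hN' : (N : ℝ) ≠ 0 := by positivity
  have h : ∀ n, ‖u n - c‖ ^ 2 = ‖u n - meanModel u‖ ^ 2
      + 2 * inner ℝ (u n - meanModel u) (meanModel u - c) + ‖meanModel u - c‖ ^ 2 := fun n => by
    rw [← norm_add_sq_real]; congr 2; abel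
  have h0 : (1 / (N : ℝ)) * ∑ n, inner ℝ (u n - meanModel u) (meanModel u - c) = 0 := by
    rw [← inner_meanModel_left, meanModel_sub, meanModel_const hN, sub_self, inner_zero_left]
  simp only [h, Finset.sum_add_distrib, mul_add, ← Finset.mul_sum]
  rw [mul_left_comm, h0]
  simp [dispersion, hN']

lemma dispersion_le (hN : 0 < N) (u : Fin N → Model d) (c : Model d) :
    dispersion u ≤ (1 / (N : ℝ)) * ∑ n, ‖u n - c‖ ^ 2 := by
  rw [mean_norm_sub_sq hN]; nlinarith [sq_nonneg ‖meanModel u - c‖]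

lemma norm_meanModel_sub_sq_le (hN : 0 < N) (u : Fin N → Model d) (c : Model d) :
    ‖meanModel u - c‖ ^ 2 ≤ (1 / (N : ℝ)) * ∑ n, ‖u n - c‖ ^ 2 := by
  rw [mean_norm_sub_sq hN]; linarith [dispersion_nonneg u]

lemma norm_meanModel_sq_le (hN : 0 < N) (u : Fin N → Model d) :
    ‖meanModel u‖ ^ 2 ≤ (1 / (N : ℝ)) * ∑ n, ‖u n‖ ^ 2 := by
  simpa using norm_meanModel_sub_sq_le hN u 0

lemma norm_meanModel_le (hN : 0 < N) (u : Fin N → Model d) {c : ℝ} (h : ∀ n, ‖u n‖ ≤ c) :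
    ‖meanModel u‖ ≤ c := by
  have hN' : (N : ℝ) ≠ 0 := by positivity
  calc ‖meanModel u‖ ≤ (1 / (N : ℝ)) * ∑ n, ‖u n‖ := by
        rw [meanModel, norm_smul, Real.norm_of_nonneg (by positivity)]
        gcongr; exact norm_sum_le _ _
    _ ≤ (1 / (N : ℝ)) * ∑ _n : Fin N, c := by gcongr with n; exact h n
    _ = c := by simp [hN']

end MeanModel

/-! ### Strongly monotone Lipschitz maps and their zeros. -/

section RegularMap

variable {d : ℕ}

/-- A map on models that behaves like the gradient of a `μ`-strongly convex function with
`L`-Lipschitz gradient. -/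
structure RegularMap (μ L : ℝ) (G : Model d → Model d) : Prop where
  mono : ∀ x y, μ * ‖x - y‖ ^ 2 ≤ inner ℝ (G x - G y) (x - y)
  lip : ∀ x y, ‖G x - G y‖ ≤ L * ‖x - y‖

variable {μ L : ℝ} {G : Model d → Model d}

lemma RegularMap.meanModel {N : ℕ} (hN : 0 < N) {G : Fin N → Model d → Model d}
    (h : ∀ n, RegularMap μ L (G n)) : RegularMap μ L (fun x => meanModel fun n => G n x) where
  mono x y := by
    have hN' : (N : ℝ) ≠ 0 := by positivity
    rw [← meanModel_sub, inner_meanModel_left]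
    calc μ * ‖x - y‖ ^ 2 = (1 / (N : ℝ)) * ∑ _n : Fin N, μ * ‖x - y‖ ^ 2 := by simp [hN']
      _ ≤ _ := by gcongr with n; exact (h n).mono x y
  lip x y := by
    rw [← meanModel_sub]
    exact norm_meanModel_le hN _ fun n => (h n).lip x y

lemma RegularMap.continuous (hG : RegularMap μ L G) (hL : 0 ≤ L) : Continuous G :=
  (LipschitzWith.of_dist_le_mul (K := ⟨L, hL⟩) fun x y => by
    rw [dist_eq_norm, dist_eq_norm]; exact hG.lip x y).continuous

/-- Expanding the square, strong monotonicity gains 2αμ‖x - y‖², and `hαL` makes the quadratic term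
cost at most αμ‖x - y‖², half of the gain. -/
lemma RegularMap.norm_step_sq_le (hG : RegularMap μ L G) {α : ℝ} (hα : 0 ≤ α)
    (hαL : α * L ^ 2 ≤ μ) (x y : Model d) :
    ‖(x - α • G x) - (y - α • G y)‖ ^ 2 ≤ (1 - α * μ) * ‖x - y‖ ^ 2 := by
  have e : (x - α • G x) - (y - α • G y) = (x - y) - α • (G x - G y) := by
    rw [smul_sub]; abel
  have h1 : ‖G x - G y‖ ^ 2 ≤ L ^ 2 * ‖x - y‖ ^ 2 := by
    rw [← mul_pow]; gcongr; exact hG.lip x y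
  have h2 := hG.mono x y
  rw [e, norm_sub_sq_real, inner_smul_right, norm_smul, mul_pow, Real.norm_eq_abs, sq_abs,
    real_inner_comm]
  have h3 : α ^ 2 * ‖G x - G y‖ ^ 2 ≤ α * μ * ‖x - y‖ ^ 2 := by
    calc α ^ 2 * ‖G x - G y‖ ^ 2 ≤ α ^ 2 * (L ^ 2 * ‖x - y‖ ^ 2) := by gcongr
      _ = α * (α * L ^ 2) * ‖x - y‖ ^ 2 := by ring
      _ ≤ α * μ * ‖x - y‖ ^ 2 := by gcongr
  nlinarith [mul_le_mul_of_nonneg_left h2 hα]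

/-- Cauchy–Schwarz applied to strong monotonicity. It gives uniqueness of zeros and turns a small
gradient into a small distance to the minimizer. -/
lemma RegularMap.norm_sub_le (hG : RegularMap μ L G) (x y : Model d) :
    μ * ‖x - y‖ ≤ ‖G x - G y‖ := by
  rcases (norm_nonneg (x - y)).eq_or_lt with h | h
  · rw [← h]; simp
  · have h1 := (hG.mono x y).trans (real_inner_le_norm _ _)
    exact le_of_mul_le_mul_right (by nlinarith) h

lemma RegularMap.norm_sub_zero_le (hG : RegularMap μ L G) {x y : Model d} (hy : G y = 0) :
    μ * ‖x - y‖ ≤ ‖G x‖ := by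
  simpa [hy] using hG.norm_sub_le x y

lemma RegularMap.zero_unique (hμ : 0 < μ) (hG : RegularMap μ L G) {x y : Model d} (hx : G x = 0)
    (hy : G y = 0) : x = y := by
  have := hG.norm_sub_zero_le (x := x) hy
  rw [hx, norm_zero] at this
  rw [← sub_eq_zero, ← norm_le_zero_iff]
  exact nonpos_of_mul_nonpos_right this hμ

/-- The zero of a regular map exists, and depends measurably on parameters. -/
lemma exists_measurable_zero (hμ : 0 < μ) {Ω : Type*} [MeasurableSpace Ω]
    {G : Ω → Model d → Model d} (hG : ∀ ω, RegularMap μ L (G ω))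
    (hm : ∀ x, Measurable fun ω => G ω x) :
    ∃ y : Ω → Model d, Measurable y ∧ ∀ ω, G ω (y ω) = 0 := by
  -- The step size must satisfy γL² ≤ μ, so that x ↦ x - γ G x contracts squared distances by 1 -
  -- γμ. The extra μ² in the denominator ensures γμ ≤ 1, so that the square root of this factor is
  -- its Lipschitz constant.
  set γ : ℝ := μ / (L ^ 2 + μ ^ 2) with hγ
  have hγ0 : 0 < γ := by positivity
  have hγL : γ * L ^ 2 ≤ μ := by
    rw [hγ, div_mul_eq_mul_div, div_le_iff₀ (by positivity)]; nlinarith [pow_pos hμ 3]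
  have hγμ : γ * μ ≤ 1 := by
    rw [hγ, div_mul_eq_mul_div, div_le_one (by positivity)]; nlinarith [sq_nonneg L]
  let T : Ω → Model d → Model d := fun ω x => x - γ • G ω x
  have hq : √(1 - γ * μ) < 1 := by
    rw [Real.sqrt_lt' one_pos]; nlinarith [mul_pos hγ0 hμ]
  have hT : ∀ ω, ContractingWith (√(1 - γ * μ)).toNNReal (T ω) := fun ω => by
    refine ⟨by rwa [Real.toNNReal_lt_one], LipschitzWith.of_dist_le_mul fun x y => ?_⟩
    rw [dist_eq_norm, dist_eq_norm, Real.coe_toNNReal _ (Real.sqrt_nonneg _)]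
    refine le_of_sq_le_sq ?_ (by positivity)
    rw [mul_pow]
    refine ((hG ω).norm_step_sq_le hγ0.le hγL x y).trans_eq ?_
    rw [Real.sq_sqrt (by linarith)]
  have hcont : ∀ ω, Continuous (T ω) := fun ω => (hT ω).2.continuous
  have hmeas : Measurable (Function.uncurry fun x ω => T ω x) :=
    measurable_uncurry_of_continuous_of_measurable hcont fun x =>
      measurable_const.sub ((hm x).const_smul γ)
  -- The Banach iterates from 0 depend measurably on ω, hence so does their limit, the fixed point.
  have hit : ∀ t : ℕ, Measurable fun ω => (T ω)^[t] 0 := fun t => by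
    induction t with
    | zero => exact measurable_const
    | succ t ih =>
      simp only [Function.iterate_succ_apply']
      exact hmeas.comp (ih.prodMk measurable_id)
  refine ⟨fun ω => ContractingWith.fixedPoint (T ω) (hT ω), ?_, fun ω => ?_⟩
  · exact measurable_of_tendsto_metrizable hit
      (tendsto_pi_nhds.2 fun ω => (hT ω).tendsto_iterate_fixedPoint 0)
  · have h : T ω _ = _ := (hT ω).fixedPoint_isFixedPt
    simp only [T, sub_eq_self, smul_eq_zero, hγ0.ne', false_or] at h
    exact h

end RegularMap

/-! ### Gradients of the local and global empirical losses. -/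

section Loss

variable {d : ℕ} {Ξ : Type*} {f : Model d → Ξ → ℝ} {μ L : ℝ}

/-- The gradient of the loss at a sample. -/
noncomputable def lossGrad (f : Model d → Ξ → ℝ) (ξ : Ξ) (x : Model d) : Model d :=
  gradient (fun u => f u ξ) x

lemma StronglyConvexLoss.regularMap (hf : StronglyConvexLoss f μ) (hs : SmoothLoss f L) (ξ : Ξ) :
    RegularMap μ L (lossGrad f ξ) where
  mono x y := by
    have h1 := (hf ξ).2 x y
    have h2 := (hf ξ).2 y x
    have e : inner ℝ (y - x) (gradient (fun u => f u ξ) x)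
        = - inner ℝ (x - y) (gradient (fun u => f u ξ) x) := by
      rw [← inner_neg_left, neg_sub]
    rw [norm_sub_rev y x, e] at h2
    rw [real_inner_comm, inner_sub_right, lossGrad, lossGrad]
    linarith
  lip := hs ξ

lemma StronglyConvexLoss.le_loss (hf : StronglyConvexLoss f μ) (hμ : 0 ≤ μ) (ξ : Ξ)
    (x y : Model d) : f y ξ + inner ℝ (lossGrad f ξ y) (x - y) ≤ f x ξ := by
  have := (hf ξ).2 x y
  rw [real_inner_comm]
  have h : 0 ≤ μ / 2 * ‖x - y‖ ^ 2 := by positivity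
  unfold lossGrad
  linarith

/-- Convexity with base point x, followed by replacing the gradient at x by the one at y. Compared
with the usual descent lemma this loses a factor 2 in the quadratic term, but needs no integration
along the segment. -/
lemma StronglyConvexLoss.loss_le (hf : StronglyConvexLoss f μ) (hs : SmoothLoss f L) (hμ : 0 ≤ μ)
    (ξ : Ξ) (x y : Model d) :
    f x ξ ≤ f y ξ + inner ℝ (lossGrad f ξ y) (x - y) + L * ‖x - y‖ ^ 2 := by
  have h1 := hf.le_loss hμ ξ y x
  have h2 : inner ℝ (lossGrad f ξ x - lossGrad f ξ y) (x - y) ≤ L * ‖x - y‖ ^ 2 := by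
    refine (real_inner_le_norm _ _).trans ?_
    have := mul_le_mul_of_nonneg_right (hs ξ x y) (norm_nonneg (x - y))
    rw [lossGrad, lossGrad]; linarith [sq ‖x - y‖]
  rw [← neg_sub x y, inner_neg_right] at h1
  rw [inner_sub_left] at h2
  linarith

lemma hasGradientAt_mean {N : ℕ} {F : Fin N → Model d → ℝ} {F' : Fin N → Model d} {x : Model d}
    (h : ∀ n, HasGradientAt (F n) (F' n) x) :
    HasGradientAt (fun y => (1 / (N : ℝ)) * ∑ n, F n y) (meanModel F') x := by
  rw [hasGradientAt_iff_hasFDerivAt]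
  have e : InnerProductSpace.toDual ℝ (Model d) (meanModel F')
      = (1 / (N : ℝ)) • ∑ n, InnerProductSpace.toDual ℝ (Model d) (F' n) := by
    simp [meanModel, map_sum]
  rw [e]
  exact (HasFDerivAt.fun_sum (u := Finset.univ) fun n _ =>
    (hasGradientAt_iff_hasFDerivAt.1 (h n))).const_mul (1 / (N : ℝ))

lemma StronglyConvexLoss.hasGradientAt (hf : StronglyConvexLoss f μ) (ξ : Ξ) (x : Model d) :
    HasGradientAt (fun u => f u ξ) (lossGrad f ξ x) x :=
  ((hf ξ).1 x).hasGradientAt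

variable {N Z : ℕ}

/-- The gradient of the local empirical loss. -/
noncomputable def localGrad (f : Model d → Ξ → ℝ) (s : Fin Z → Ξ) (x : Model d) : Model d :=
  meanModel fun z => lossGrad f (s z) x

/-- The gradient of the global empirical loss. -/
noncomputable def empiricalGrad (f : Model d → Ξ → ℝ) (S : Fin N → Fin Z → Ξ) (x : Model d) :
    Model d :=
  meanModel fun n => localGrad f (S n) x

lemma StronglyConvexLoss.hasGradientAt_localLoss (hf : StronglyConvexLoss f μ) (s : Fin Z → Ξ)
    (x : Model d) : HasGradientAt (localLoss f s) (localGrad f s x) x :=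
  hasGradientAt_mean fun z => hf.hasGradientAt (s z) x

lemma StronglyConvexLoss.hasGradientAt_empiricalLoss (hf : StronglyConvexLoss f μ)
    (S : Fin N → Fin Z → Ξ) (x : Model d) :
    HasGradientAt (empiricalLoss f S) (empiricalGrad f S x) x :=
  hasGradientAt_mean fun n => hf.hasGradientAt_localLoss (S n) x

lemma StronglyConvexLoss.regularMap_localGrad (hf : StronglyConvexLoss f μ) (hs : SmoothLoss f L)
    (hZ : 0 < Z) (s : Fin Z → Ξ) : RegularMap μ L (localGrad f s) :=
  RegularMap.meanModel hZ fun z => hf.regularMap hs (s z)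

lemma StronglyConvexLoss.regularMap_empiricalGrad (hf : StronglyConvexLoss f μ)
    (hs : SmoothLoss f L) (hN : 0 < N) (hZ : 0 < Z) (S : Fin N → Fin Z → Ξ) :
    RegularMap μ L (empiricalGrad f S) :=
  RegularMap.meanModel hN fun n => hf.regularMap_localGrad hs hZ (S n)

lemma StronglyConvexLoss.empiricalGrad_eq_zero (hf : StronglyConvexLoss f μ)
    {S : Fin N → Fin Z → Ξ} {x : Model d}
    (hx : ∀ y, empiricalLoss f S x ≤ empiricalLoss f S y) : empiricalGrad f S x = 0 := by
  have h := IsLocalMin.fderiv_eq_zero (f := empiricalLoss f S) (a := x) (Filter.Eventually.of_forall hx)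
  rw [(hasGradientAt_iff_hasFDerivAt.1 (hf.hasGradientAt_empiricalLoss S x)).fderiv] at h
  simpa using h

lemma StronglyConvexLoss.le_empiricalLoss (hf : StronglyConvexLoss f μ) (hμ : 0 ≤ μ)
    (S : Fin N → Fin Z → Ξ) (x y : Model d) :
    empiricalLoss f S y + inner ℝ (empiricalGrad f S y) (x - y) ≤ empiricalLoss f S x := by
  simp only [empiricalLoss, localLoss, empiricalGrad, localGrad, inner_meanModel_left,
    ← mul_add, ← Finset.sum_add_distrib]
  gcongr with n _ z _
  exact hf.le_loss hμ (S n z) x y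

lemma StronglyConvexLoss.empiricalLoss_le (hf : StronglyConvexLoss f μ) (hs : SmoothLoss f L)
    (hμ : 0 ≤ μ) (hN : 0 < N) (hZ : 0 < Z) (S : Fin N → Fin Z → Ξ) (x y : Model d) :
    empiricalLoss f S x
      ≤ empiricalLoss f S y + inner ℝ (empiricalGrad f S y) (x - y) + L * ‖x - y‖ ^ 2 := by
  have hN' : (N : ℝ) ≠ 0 := by positivity
  have hZ' : (Z : ℝ) ≠ 0 := by positivity
  have e : L * ‖x - y‖ ^ 2 = (1 / (N : ℝ)) * ∑ _n : Fin N, (1 / (Z : ℝ)) * ∑ _z : Fin Z,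
      L * ‖x - y‖ ^ 2 := by simp [hN', hZ']
  rw [e]
  simp only [empiricalLoss, localLoss, empiricalGrad, localGrad, inner_meanModel_left,
    ← mul_add, ← Finset.sum_add_distrib]
  gcongr with n _ z _
  exact hf.loss_le hs hμ (S n z) x y

/-- The mean square deviation of the gradients at all samples from the global gradient. -/
lemma mean_norm_lossGrad_sub_le (hf : StronglyConvexLoss f μ) (hZ : 0 < Z)
    {S : Fin N → Fin Z → Ξ} {σ δ : ℝ} (hN : 0 < N) (hσ : BoundedNoise f S σ)
    (hδ : BoundedHeterogeneity f S δ) (x : Model d) :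
    (1 / (N : ℝ)) * ∑ n, (1 / (Z : ℝ)) * ∑ z, ‖lossGrad f (S n z) x - empiricalGrad f S x‖ ^ 2
      ≤ σ ^ 2 + δ ^ 2 := by
  have hN' : (N : ℝ) ≠ 0 := by positivity
  have h1 := fun n => hσ x n
  have h2 := hδ x
  simp only [(hf.hasGradientAt_localLoss _ x).gradient,
    (hf.hasGradientAt_empiricalLoss _ x).gradient] at h1 h2
  calc _ = (1 / (N : ℝ)) * ∑ n, ((1 / (Z : ℝ)) * ∑ z, ‖lossGrad f (S n z) x - localGrad f (S n) x‖ ^ 2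
        + ‖localGrad f (S n) x - empiricalGrad f S x‖ ^ 2) := by
        congr 1; refine Finset.sum_congr rfl fun n _ => ?_
        rw [mean_norm_sub_sq hZ]; rfl
    _ ≤ (1 / (N : ℝ)) * ∑ n, (σ ^ 2 + ‖localGrad f (S n) x - empiricalGrad f S x‖ ^ 2) := by
        gcongr with n; exact h1 n
    _ ≤ σ ^ 2 + δ ^ 2 := by
        rw [Finset.sum_add_distrib, mul_add]
        gcongr
        simp [hN']

end Loss

/-! ### One round of robust aggregation. -/

section Aggregation

variable {d N B : ℕ}

/-- The matrix acts on each of the d coordinates separately, so the operator norm bound is applied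
coordinatewise and summed, with no dependence on d. -/
lemma sum_norm_sq_matrix_smul_le (M : Matrix (Fin N) (Fin N) ℝ) (v : Fin N → Model d) :
    ∑ n, ‖∑ m, M n m • v m‖ ^ 2
      ≤ ‖Matrix.toEuclideanCLM (n := Fin N) (𝕜 := ℝ) M‖ ^ 2 * ∑ m, ‖v m‖ ^ 2 := by
  have hc : ∀ i : Fin d, ∑ n, (∑ m, M n m * v m i) ^ 2
      ≤ ‖Matrix.toEuclideanCLM (n := Fin N) (𝕜 := ℝ) M‖ ^ 2 * ∑ m, (v m i) ^ 2 := fun i => by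
    have h := (Matrix.toEuclideanCLM (n := Fin N) (𝕜 := ℝ) M).le_opNorm
      (WithLp.toLp 2 fun m => v m i)
    have h2 := pow_le_pow_left₀ (norm_nonneg _) h 2
    rw [mul_pow, EuclideanSpace.real_norm_sq_eq, EuclideanSpace.real_norm_sq_eq] at h2
    simpa [Matrix.ofLp_toEuclideanCLM, Matrix.mulVec, dotProduct] using h2
  simp only [EuclideanSpace.real_norm_sq_eq]
  rw [Finset.sum_comm, Finset.sum_comm (s := Finset.univ (α := Fin N)) (t := Finset.univ (α := Fin d)),
    Finset.mul_sum]
  refine Finset.sum_le_sum fun i _ => ?_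
  simpa using hc i

lemma dispersion_sub_const (hN : 0 < N) (u : Fin N → Model d) (c : Model d) :
    dispersion (fun n => u n - c) = dispersion u := by
  simp [dispersion, meanModel_sub, meanModel_const hN]

/-- Mixing with a stochastic matrix contracts the dispersion. -/
lemma dispersion_mix_le (hN : 0 < N) {W : Matrix (Fin N) (Fin N) ℝ} (hW : ∀ n, ∑ m, W n m = 1)
    (u : Fin N → Model d) :
    dispersion (fun n => ∑ m, W n m • u m) ≤ (1 - mixingGap W) * dispersion u := by
  set c := meanModel u
  -- Since rows sum to one, mixing acts on the centred models `v`. Mixing and then removing the new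
  -- mean is multiplication by `M`, whose norm defines `mixingGap`.
  have e1 : (fun n => ∑ m, W n m • u m - c) = fun n => ∑ m, W n m • (u m - c) := by
    funext n
    simp [smul_sub, Finset.sum_sub_distrib, ← Finset.sum_smul, hW]
  rw [← dispersion_sub_const hN _ c, e1]
  set v := fun m => u m - c
  obtain ⟨M, hM⟩ : ∃ M : Matrix (Fin N) (Fin N) ℝ,
      M = (1 - (1 / (N : ℝ)) • Matrix.of (fun _ _ => (1 : ℝ))) * W := ⟨_, rfl⟩
  have e2 : ∀ n, ∑ m, M n m • v m
      = ∑ m, W n m • v m - meanModel fun n => ∑ m, W n m • v m := fun n => by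
    have : ∀ m, M n m
        = W n m - (1 / (N : ℝ)) * ∑ n', W n' m := fun m => by
      rw [hM, sub_mul, one_mul, Matrix.sub_apply, smul_mul_assoc, Matrix.smul_apply, Matrix.mul_apply]
      simp
    simp only [this, sub_smul, Finset.sum_sub_distrib, meanModel]
    congr 1
    rw [Finset.sum_comm, Finset.smul_sum]
    refine Finset.sum_congr rfl fun m _ => ?_
    rw [mul_smul, Finset.sum_smul]
  have h := sum_norm_sq_matrix_smul_le M v
  simp only [e2] at h
  have hg : 1 - mixingGap W = ‖Matrix.toEuclideanCLM (n := Fin N) (𝕜 := ℝ)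
    M‖ ^ 2 := by
    simp [mixingGap, hM]
  rw [hg, dispersion, dispersion, mul_left_comm]
  exact mul_le_mul_of_nonneg_left h (by positivity)

/-- Centring is linear, so Young's inequality applies to the centred parts agent by agent. The
centring of the perturbation `e` is then dropped, as it only lowers the mean square. -/
lemma dispersion_add_le (hN : 0 < N) (u e : Fin N → Model d) {η : ℝ} (hη : 0 < η) :
    dispersion (fun n => u n + e n)
      ≤ (1 + η) * dispersion u + (1 + 1 / η) * ((1 / (N : ℝ)) * ∑ n, ‖e n‖ ^ 2) := by
  have h0 : dispersion e ≤ (1 / (N : ℝ)) * ∑ n, ‖e n‖ ^ 2 := by simpa using dispersion_le hN e 0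
  calc dispersion (fun n => u n + e n)
      = (1 / (N : ℝ)) * ∑ n, ‖(u n - meanModel u) + (e n - meanModel e)‖ ^ 2 := by
        simp only [dispersion, meanModel_add, add_sub_add_comm]
    _ ≤ (1 / (N : ℝ)) * ∑ n, ((1 + η) * ‖u n - meanModel u‖ ^ 2
          + (1 + 1 / η) * ‖e n - meanModel e‖ ^ 2) := by
        gcongr with n; exact norm_add_sq_le_young _ _ hη
    _ = (1 + η) * dispersion u + (1 + 1 / η) * dispersion e := by
        rw [Finset.sum_add_distrib, ← Finset.mul_sum, ← Finset.mul_sum, dispersion, dispersion]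
        ring
    _ ≤ _ := by gcongr

/-- One summand is at most the whole sum. This passage from mean square to maximum is the source of
the factor √N in the condition on ρ. -/
lemma norm_sub_meanModel_le (hN : 0 < N) (u : Fin N → Model d) (n : Fin N) :
    ‖u n - meanModel u‖ ≤ √(N * dispersion u) := by
  refine Real.le_sqrt_of_sq_le ?_
  have hN' : (N : ℝ) ≠ 0 := by positivity
  have : N * dispersion u = ∑ n, ‖u n - meanModel u‖ ^ 2 := by
    rw [dispersion, ← mul_assoc, mul_one_div_cancel hN', one_mul]
  rw [this]
  exact Finset.single_le_sum (f := fun n => ‖u n - meanModel u‖ ^ 2)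
    (fun _ _ => by positivity) (Finset.mem_univ n)

variable {G : SimpleGraph (Fin N ⊕ Fin B)} {A : (n : Fin N) → AggregationRule G d n}
  {W : Matrix (Fin N) (Fin N) ℝ} {ρ : ℝ}

/-- The aggregation output is close to the virtual mixing of the models. -/
lemma IsVirtualMixing.norm_sub_sq_le (hA : IsVirtualMixing G A W ρ) (hN : 0 < N)
    (u : Fin N → Model d) (v : Fin B → Model d) (n : Fin N) :
    ‖A n (u n) (fun m => Sum.elim u v m.1) - ∑ m, W n m • u m‖ ^ 2
      ≤ 4 * ρ ^ 2 * N * dispersion u := by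
  have h := hA.contraction n u v
  set s := √(N * dispersion u)
  have hs0 : 0 ≤ s := Real.sqrt_nonneg _
  -- A convex combination of points in the ball of radius `s` around the average stays in that ball.
  have hmix : ‖∑ m', W n m' • u m' - meanModel u‖ ≤ s := by
    have e : ∑ m', W n m' • u m' - meanModel u = ∑ m', W n m' • (u m' - meanModel u) := by
      simp [smul_sub, Finset.sum_sub_distrib, ← Finset.sum_smul, hA.row_sum]
    rw [e]
    calc _ ≤ ∑ m', ‖W n m' • (u m' - meanModel u)‖ := norm_sum_le _ _
      _ ≤ ∑ m', W n m' * s := by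
          gcongr with m'
          rw [norm_smul, Real.norm_of_nonneg (hA.weight_mem n m').1]
          have := (hA.weight_mem n m').1
          gcongr
          exact norm_sub_meanModel_le hN u m'
      _ = s := by rw [← Finset.sum_mul, hA.row_sum, one_mul]
  have hsup : (⨆ m : {m : Fin N // m = n ∨ G.Adj (Sum.inl n) (Sum.inl m)},
        ‖u m.1 - ∑ m', W n m' • u m'‖) ≤ 2 * s := by
    refine Real.iSup_le (fun m => ?_) (by positivity)
    have h1 := norm_sub_meanModel_le hN u m.1
    have h2 := norm_sub_le (u m.1 - meanModel u) (∑ m', W n m' • u m' - meanModel u)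
    rw [sub_sub_sub_cancel_right] at h2
    linarith
  have h3 := h.trans (mul_le_mul_of_nonneg_left hsup hA.rho_nonneg)
  calc _ ≤ (ρ * (2 * s)) ^ 2 := by gcongr
    _ = 4 * ρ ^ 2 * s ^ 2 := by ring
    _ = _ := by
      rw [Real.sq_sqrt (mul_nonneg (Nat.cast_nonneg _) (dispersion_nonneg u))]; ring

/-- One round of robust aggregation contracts the dispersion. -/
lemma IsVirtualMixing.dispersion_le (hA : IsVirtualMixing G A W ρ) (hN : 0 < N) {lam : ℝ}
    (hlam : 0 < lam) (hgap : mixingGap W = lam) (hρ : ρ < lam / (8 * √(N : ℝ)))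
    (u : Fin N → Model d) (v : Fin N → Fin B → Model d) :
    dispersion (fun n => A n (u n) (fun m => Sum.elim u (v n) m.1))
      ≤ (1 - lam / 4) * dispersion u := by
  have hN' : (0 : ℝ) < N := by positivity
  set e : Fin N → Model d :=
    fun n => A n (u n) (fun m => Sum.elim u (v n) m.1) - ∑ m, W n m • u m with he
  have hu := dispersion_nonneg u
  have hlam1 : lam ≤ 1 := by
    rw [← hgap, mixingGap]; nlinarith [sq_nonneg ‖Matrix.toEuclideanCLM (n := Fin N) (𝕜 := ℝ)
      ((1 - (1 / (N : ℝ)) • Matrix.of (fun _ _ => (1 : ℝ))) * W)‖]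
  have hρ2 : 4 * ρ ^ 2 * N ≤ lam ^ 2 / 16 := by
    have h1 : ρ * √(N : ℝ) ≤ lam / 8 := by
      have := (lt_div_iff₀ (by positivity)).1 hρ; linarith
    have h2 : (ρ * √(N : ℝ)) ^ 2 ≤ (lam / 8) ^ 2 := by
      have := hA.rho_nonneg; gcongr
    rw [mul_pow, Real.sq_sqrt hN'.le] at h2
    linarith
  have hmean : (1 / (N : ℝ)) * ∑ n, ‖e n‖ ^ 2 ≤ lam ^ 2 / 16 * dispersion u := by
    calc (1 / (N : ℝ)) * ∑ n, ‖e n‖ ^ 2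
        ≤ (1 / (N : ℝ)) * ∑ _n : Fin N, lam ^ 2 / 16 * dispersion u := by
          gcongr with n
          exact (hA.norm_sub_sq_le hN u (v n) n).trans (by gcongr)
      _ = _ := by simp [hN'.ne']
  -- Young parameter λ/2: the mixing part keeps (1 + λ/2)(1 - λ) and the error part adds (1 + 2/λ)
  -- λ²/16 = λ²/16 + λ/8, together at most 1 - λ/4.
  have h1 := dispersion_add_le hN (fun n => ∑ m, W n m • u m) e (half_pos hlam)
  have h2 := dispersion_mix_le hN hA.row_sum u
  rw [hgap] at h2
  simp only [he, add_sub_cancel] at h1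
  refine h1.trans ?_
  calc _ ≤ (1 + lam / 2) * ((1 - lam) * dispersion u)
        + (1 + 1 / (lam / 2)) * (lam ^ 2 / 16 * dispersion u) := by gcongr
    _ = ((1 + lam / 2) * (1 - lam) + (lam ^ 2 / 16 + lam / 8)) * dispersion u := by
        field_simp; ring
    _ ≤ (1 - lam / 4) * dispersion u := by gcongr; nlinarith

/-- One round of robust aggregation moves the average model by at most the dispersion. -/
lemma IsVirtualMixing.norm_meanModel_sub_sq_le (hA : IsVirtualMixing G A W ρ) (hN : 0 < N)
    (u : Fin N → Model d) (v : Fin N → Fin B → Model d) :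
    ‖meanModel (fun n => A n (u n) (fun m => Sum.elim u (v n) m.1)) - meanModel u‖ ^ 2
      ≤ 2 * (4 * ρ ^ 2 * N + chiSq W) * dispersion u := by
  have hN' : (0 : ℝ) < N := by positivity
  set e : Fin N → Model d :=
    fun n => A n (u n) (fun m => Sum.elim u (v n) m.1) - ∑ m, W n m • u m with he
  have hu := dispersion_nonneg u
  have hmean : ‖meanModel e‖ ^ 2 ≤ 4 * ρ ^ 2 * N * dispersion u := by
    refine (norm_meanModel_sq_le hN e).trans ?_
    calc (1 / (N : ℝ)) * ∑ n, ‖e n‖ ^ 2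
        ≤ (1 / (N : ℝ)) * ∑ _n : Fin N, 4 * ρ ^ 2 * N * dispersion u := by
          gcongr with n
          exact hA.norm_sub_sq_le hN u (v n) n
      _ = _ := by simp [hN'.ne']
  -- The excess column sums measure how far mixing fails to preserve the average. They add up to
  -- zero, so the models may be centred before Cauchy–Schwarz, which yields χ² times the dispersion.
  set c : Fin N → ℝ := fun m => ∑ n, W n m - 1
  have hc : ∑ m, c m = 0 := by
    simp only [c, Finset.sum_sub_distrib]
    rw [Finset.sum_comm]; simp [hA.row_sum]
  have hdrift : meanModel (fun n => ∑ m, W n m • u m) - meanModel u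
      = (1 / (N : ℝ)) • ∑ m, c m • (u m - meanModel u) := by
    simp only [smul_sub, Finset.sum_sub_distrib, ← Finset.sum_smul, hc, zero_smul, sub_zero]
    simp only [c, sub_smul, one_smul, Finset.sum_sub_distrib, Finset.sum_smul, smul_sub]
    rw [Finset.sum_comm]; rfl
  have hdrift2 : ‖meanModel (fun n => ∑ m, W n m • u m) - meanModel u‖ ^ 2
      ≤ chiSq W * dispersion u := by
    rw [hdrift, norm_smul, mul_pow, Real.norm_of_nonneg (by positivity), chiSq, dispersion]
    have h1 : ‖∑ m, c m • (u m - meanModel u)‖ ^ 2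
        ≤ (∑ m, |c m| * ‖u m - meanModel u‖) ^ 2 := by
      gcongr
      refine (norm_sum_le _ _).trans_eq ?_
      simp [norm_smul]
    have h2 := h1.trans (Finset.sum_mul_sq_le_sq_mul_sq Finset.univ _ _)
    simp only [sq_abs] at h2
    calc _ ≤ (1 / (N : ℝ)) ^ 2 * ((∑ m, c m ^ 2) * ∑ m, ‖u m - meanModel u‖ ^ 2) := by gcongr
      _ = _ := by ring
  have hsplit : meanModel (fun n => A n (u n) (fun m => Sum.elim u (v n) m.1)) - meanModel u
      = (meanModel (fun n => ∑ m, W n m • u m) - meanModel u) + meanModel e := by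
    rw [he, meanModel_sub]; abel
  rw [hsplit]
  refine (norm_add_sq_le_two _ _).trans ?_
  linarith

end Aggregation

/-! ### Pathwise effect of a gradient step. -/

section HalfStep

variable {d N Z : ℕ} {Ξ : Type*} {f : Model d → Ξ → ℝ} {μ L : ℝ}

/-- The mean squared gradient noise at the average model. -/
noncomputable def noiseAt (f : Model d → Ξ → ℝ) (S : Fin N → Fin Z → Ξ) (i : Fin N → Fin Z)
    (y : Model d) : ℝ :=
  (1 / (N : ℝ)) * ∑ n, ‖lossGrad f (S n (i n)) y - localGrad f (S n) y‖ ^ 2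

/-- Growth of the dispersion in a gradient step. -/
lemma dispersion_halfStep_le (hf : StronglyConvexLoss f μ) (hs : SmoothLoss f L) (hN : 0 < N)
    {S : Fin N → Fin Z → Ξ} {δ : ℝ}
    (hδ : BoundedHeterogeneity f S δ) {lam α : ℝ} (hlam : 0 < lam)
    (hα : (1 + 16 / lam) * (3 * α ^ 2 * L ^ 2) ≤ lam / 16) (i : Fin N → Fin Z)
    (x : Fin N → Model d) :
    dispersion (halfStep f S α i x) ≤ (1 + lam / 8) * dispersion x
      + 3 * (1 + 16 / lam) * α ^ 2 * (noiseAt f S i (meanModel x) + δ ^ 2) := by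
  set y := meanModel x
  -- Subtracting a common vector leaves the dispersion unchanged, so only deviations of the drawn
  -- gradients from `c` matter. They split into a Lipschitz part, sampling noise at the average
  -- model and heterogeneity. Taking the noise at `y` gives all agents one point, known before the
  -- draw.
  set c := empiricalGrad f S y
  set g : Fin N → Model d := fun n => lossGrad f (S n (i n)) (x n)
  have hgn : ∀ n, ‖g n - c‖ ^ 2 ≤ 3 * (L ^ 2 * ‖x n - y‖ ^ 2)
      + 3 * ‖lossGrad f (S n (i n)) y - localGrad f (S n) y‖ ^ 2
      + 3 * ‖localGrad f (S n) y - c‖ ^ 2 := fun n => by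
    have e : g n - c = (g n - lossGrad f (S n (i n)) y)
        + (lossGrad f (S n (i n)) y - localGrad f (S n) y) + (localGrad f (S n) y - c) := by abel
    have h1 : ‖g n - lossGrad f (S n (i n)) y‖ ≤ L * ‖x n - y‖ := hs _ _ _
    have h2 := norm_add₃_le (a := g n - lossGrad f (S n (i n)) y)
      (b := lossGrad f (S n (i n)) y - localGrad f (S n) y) (c := localGrad f (S n) y - c)
    rw [← e] at h2
    have h3 := h2.trans (add_le_add_left (add_le_add_left h1 _) _)
    have h4 := pow_le_pow_left₀ (norm_nonneg _) h3 2
    nlinarith [sq_nonneg (L * ‖x n - y‖ - ‖lossGrad f (S n (i n)) y - localGrad f (S n) y‖),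
      sq_nonneg (L * ‖x n - y‖ - ‖localGrad f (S n) y - c‖),
      sq_nonneg (‖lossGrad f (S n (i n)) y - localGrad f (S n) y‖ - ‖localGrad f (S n) y - c‖)]
  have hδ' : (1 / (N : ℝ)) * ∑ n, ‖localGrad f (S n) y - c‖ ^ 2 ≤ δ ^ 2 := by
    have := hδ y
    simpa only [(hf.hasGradientAt_localLoss _ y).gradient,
      (hf.hasGradientAt_empiricalLoss _ y).gradient] using this
  have hg : (1 / (N : ℝ)) * ∑ n, ‖g n - c‖ ^ 2
      ≤ 3 * L ^ 2 * dispersion x + 3 * noiseAt f S i y + 3 * δ ^ 2 := by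
    calc _ ≤ (1 / (N : ℝ)) * ∑ n, (3 * (L ^ 2 * ‖x n - y‖ ^ 2)
        + 3 * ‖lossGrad f (S n (i n)) y - localGrad f (S n) y‖ ^ 2
        + 3 * ‖localGrad f (S n) y - c‖ ^ 2) := by gcongr with n; exact hgn n
      _ = 3 * L ^ 2 * dispersion x + 3 * noiseAt f S i y
          + 3 * ((1 / (N : ℝ)) * ∑ n, ‖localGrad f (S n) y - c‖ ^ 2) := by
        simp only [Finset.sum_add_distrib, ← Finset.mul_sum, dispersion, noiseAt]; ring
      _ ≤ _ := by gcongr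
  have e : dispersion (halfStep f S α i x)
      = dispersion (fun n => x n + (- α) • (g n - c)) := by
    have : (fun n => x n + (- α) • (g n - c)) = fun n => halfStep f S α i x n - (- α) • c := by
      funext n; simp only [halfStep, g, lossGrad]; module
    rw [this, dispersion_sub_const hN]
  rw [e]
  -- One λ/16 of growth comes from Young's inequality and a second from the Lipschitz part via `hα`;
  -- the total 1 + λ/8 is outweighed by the contraction 1 - λ/4 of aggregation.
  refine (dispersion_add_le hN _ _ (η := lam / 16) (by positivity)).trans ?_
  have hsm : (1 / (N : ℝ)) * ∑ n, ‖(- α) • (g n - c)‖ ^ 2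
      = α ^ 2 * ((1 / (N : ℝ)) * ∑ n, ‖g n - c‖ ^ 2) := by
    simp only [norm_smul, mul_pow, norm_neg, Real.norm_eq_abs, sq_abs, ← Finset.mul_sum]; ring
  rw [hsm, one_div_div]
  have hd := dispersion_nonneg x
  calc _ ≤ (1 + lam / 16) * dispersion x + (1 + 16 / lam)
        * (α ^ 2 * (3 * L ^ 2 * dispersion x + 3 * noiseAt f S i y + 3 * δ ^ 2)) := by gcongr
    _ = (1 + lam / 16) * dispersion x + (1 + 16 / lam) * (3 * α ^ 2 * L ^ 2) * dispersion x
        + 3 * (1 + 16 / lam) * α ^ 2 * (noiseAt f S i y + δ ^ 2) := by ring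
    _ ≤ (1 + lam / 16) * dispersion x + lam / 16 * dispersion x
        + 3 * (1 + 16 / lam) * α ^ 2 * (noiseAt f S i y + δ ^ 2) := by gcongr
    _ = _ := by ring

/-- The expected gradient step contracts the distance to the minimizer up to the dispersion. -/
lemma norm_meanStep_sub_sq_le (hf : StronglyConvexLoss f μ) (hs : SmoothLoss f L) (hN : 0 < N)
    (hZ : 0 < Z) {S : Fin N → Fin Z → Ξ} {xS : Model d} (hxS : empiricalGrad f S xS = 0)
    {α τ : ℝ} (hα : 0 ≤ α) (hαL : α * L ^ 2 ≤ μ) (hτ : 0 < τ) (x : Fin N → Model d) :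
    ‖meanModel x - xS - α • meanModel (fun n => localGrad f (S n) (x n))‖ ^ 2
      ≤ (1 + τ) * (1 - α * μ) * ‖meanModel x - xS‖ ^ 2
        + (1 + 1 / τ) * (α ^ 2 * L ^ 2 * dispersion x) := by
  set y := meanModel x
  have h1 := (hf.regularMap_empiricalGrad hs hN hZ S).norm_step_sq_le hα hαL y xS
  rw [hxS, smul_zero, sub_zero] at h1
  -- The averaged step is an exact gradient step of the empirical loss at the average model,
  -- perturbed by evaluating local gradients at local models.
  set w : Fin N → Model d := fun n => localGrad f (S n) y - localGrad f (S n) (x n)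
  have hw : ‖meanModel w‖ ^ 2 ≤ L ^ 2 * dispersion x := by
    refine (norm_meanModel_sq_le hN w).trans ?_
    calc _ ≤ (1 / (N : ℝ)) * ∑ n, (L ^ 2 * ‖x n - y‖ ^ 2) := by
          gcongr with n
          rw [norm_sub_rev (x n), ← mul_pow]
          gcongr
          exact (hf.regularMap_localGrad hs hZ (S n)).lip _ _
      _ = _ := by rw [← Finset.mul_sum, dispersion]; ring
  have e : y - xS - α • meanModel (fun n => localGrad f (S n) (x n))
      = (y - α • empiricalGrad f S y - xS) + α • meanModel w := by
    simp only [w, meanModel_sub, empiricalGrad]; module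
  rw [e]
  refine (norm_add_sq_le_young _ _ hτ).trans ?_
  rw [norm_smul, mul_pow, Real.norm_eq_abs, sq_abs]
  calc _ ≤ (1 + τ) * ((1 - α * μ) * ‖y - xS‖ ^ 2)
        + (1 + 1 / τ) * (α ^ 2 * (L ^ 2 * dispersion x)) := by gcongr
    _ = _ := by ring

end HalfStep

/-! ### Square integrability and measurability. -/

section SquareIntegrable

variable {d N : ℕ} {Ω : Type*} {mΩ : MeasurableSpace Ω} {P : Measure Ω}

lemma MeasureTheory.MemLp.integrable_norm_sq {u : Ω → Model d} (hu : MemLp u 2 P) :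
    Integrable (fun ω => ‖u ω‖ ^ 2) P :=
  (memLp_two_iff_integrable_sq_norm hu.1).1 hu

lemma MeasureTheory.MemLp.integrable_inner_two {u v : Ω → Model d} (hu : MemLp u 2 P)
    (hv : MemLp v 2 P) : Integrable (fun ω => inner ℝ (u ω) (v ω)) P := by
  refine (hu.integrable_norm_sq.add hv.integrable_norm_sq).mono' (hu.1.inner hv.1)
    (Filter.Eventually.of_forall fun ω => ?_)
  have := abs_real_inner_le_norm (u ω) (v ω)
  simp only [Real.norm_eq_abs, Pi.add_apply]
  nlinarith [sq_nonneg (‖u ω‖ - ‖v ω‖)]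

lemma memLp_meanModel {u : Ω → Fin N → Model d} (hu : ∀ n, MemLp (fun ω => u ω n) 2 P) :
    MemLp (fun ω => meanModel (u ω)) 2 P :=
  (memLp_finsetSum Finset.univ fun n _ => hu n).const_smul (1 / (N : ℝ))

lemma memLp_meanModel_sub (hN : 0 < N) {u : Ω → Fin N → Model d} {c : Ω → Model d}
    (hu : ∀ n, MemLp (fun ω => u ω n - c ω) 2 P) :
    MemLp (fun ω => meanModel (u ω) - c ω) 2 P := by
  have h := memLp_meanModel hu
  simp only [meanModel_sub, meanModel_const hN] at h
  exact h

lemma integrable_mean_norm_sq {u : Ω → Fin N → Model d} (hu : ∀ n, MemLp (fun ω => u ω n) 2 P) :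
    Integrable (fun ω => (1 / (N : ℝ)) * ∑ n, ‖u ω n‖ ^ 2) P :=
  (integrable_finsetSum _ fun n _ => (hu n).integrable_norm_sq).const_mul _

lemma integrable_dispersion (hN : 0 < N) {u : Ω → Fin N → Model d} {c : Ω → Model d}
    (hu : ∀ n, MemLp (fun ω => u ω n - c ω) 2 P) :
    Integrable (fun ω => dispersion (u ω)) P := by
  refine integrable_mean_norm_sq (u := fun ω n => u ω n - meanModel (u ω)) fun n => ?_
  refine ((hu n).sub (memLp_meanModel_sub hN hu)).ae_eq (Filter.Eventually.of_forall fun ω => ?_)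
  simp

end SquareIntegrable

section GradientMeasurability

variable {d : ℕ} {Ξ : Type*} [MeasurableSpace Ξ] {f : Model d → Ξ → ℝ} {μ L : ℝ}

/-- Directional derivatives are limits of the difference quotients n (f(x + v/n; ξ) - f(x; ξ)), each
measurable in ξ; the coordinates of the gradient are such limits. -/
lemma StronglyConvexLoss.measurable_lossGrad (hf : StronglyConvexLoss f μ)
    (hm : ∀ x, Measurable (f x)) (x : Model d) : Measurable fun ξ => lossGrad f ξ x := by
  have h : ∀ v, Measurable fun ξ => inner ℝ (lossGrad f ξ x) v := fun v => by
    refine measurable_of_tendsto_metrizable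
      (f := fun (n : ℕ) ξ => (n : ℝ) • (f (x + ((n : ℝ))⁻¹ • v) ξ - f x ξ)) (fun n => ?_) ?_
    · exact Measurable.const_smul (M := ℝ) ((hm _).sub (hm _)) _
    · refine tendsto_pi_nhds.2 fun ξ => ?_
      have h1 := (hasGradientAt_iff_hasFDerivAt.1 (hf.hasGradientAt ξ x)).lim v
        (c := fun n : ℕ => (n : ℝ)) (l := Filter.atTop)
        (by simpa using tendsto_natCast_atTop_atTop (R := ℝ))
      simpa using h1
  have e : (fun ξ => lossGrad f ξ x) = fun ξ => ∑ i, inner ℝ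
      (lossGrad f ξ x) (EuclideanSpace.basisFun (Fin d) ℝ i) • EuclideanSpace.basisFun (Fin d) ℝ i := by
    funext ξ
    conv_lhs => rw [← (EuclideanSpace.basisFun (Fin d) ℝ).sum_repr' (lossGrad f ξ x)]
    simp only [real_inner_comm]
  rw [e]
  exact Finset.measurable_sum _ fun i _ => (h _).smul_const _

lemma StronglyConvexLoss.measurable_uncurry_lossGrad (hf : StronglyConvexLoss f μ)
    (hs : SmoothLoss f L) (hL : 0 ≤ L) (hm : ∀ x, Measurable (f x)) :
    Measurable fun p : Model d × Ξ => lossGrad f p.2 p.1 :=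
  measurable_uncurry_of_continuous_of_measurable
    (u := fun x ξ => lossGrad f ξ x) (fun ξ => (hf.regularMap hs ξ).continuous hL)
    (hf.measurable_lossGrad hm)

lemma StronglyConvexLoss.measurable_uncurry_loss (hf : StronglyConvexLoss f μ)
    (hm : ∀ x, Measurable (f x)) : Measurable fun p : Model d × Ξ => f p.1 p.2 :=
  measurable_uncurry_of_continuous_of_measurable (u := f) (fun ξ => (hf ξ).1.continuous) hm

end GradientMeasurability

/-! ### Uniform draws independent of the past. -/

section Draws

variable {N B Z d : ℕ} {Ξ Ω : Type*} [MeasurableSpace Ξ] {mΩ : MeasurableSpace Ω} {P : Measure Ω}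
  {𝓕 : Filtration ℕ mΩ} {D : Fin N → Measure Ξ} {S : Ω → Fin N → Fin Z → Ξ}
  {idx : ℕ → Ω → Fin N → Fin Z} {byz : ℕ → Fin B → Fin N → Ω → Model d}

lemma card_filter_apply_eq (n : Fin N) (z : Fin Z) :
    (Finset.univ.filter fun j : Fin N → Fin Z => j n = z).card = Z ^ (N - 1) := by
  have : (Finset.univ.filter fun j : Fin N → Fin Z => j n = z)
      = Fintype.piFinset fun m => if m = n then {z} else Finset.univ := by
    ext j
    simp only [Finset.mem_filter, Finset.mem_univ, true_and, Fintype.mem_piFinset]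
    constructor
    · intro h m
      by_cases hm : m = n
      · subst hm; simp [h]
      · simp [hm]
    · intro h
      simpa using h n
  rw [this, Fintype.card_piFinset]
  simp only [apply_ite Finset.card, Finset.card_singleton, Finset.card_univ, Fintype.card_fin]
  rw [Finset.prod_ite]
  simp [Finset.filter_ne']

lemma IsByzantineSetup.measurable_idx (h : IsByzantineSetup P 𝓕 D S idx byz) (k : ℕ) (n : Fin N) :
    Measurable[𝓕 (k + 1)] fun ω => idx k ω n :=
  (measurable_pi_apply n).comp (h.idx_meas k)

lemma IsByzantineSetup.measure_idx_eq (h : IsByzantineSetup P 𝓕 D S idx byz) (hZ : 0 < Z) (k : ℕ)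
    (n : Fin N) (z : Fin Z) : P.real {ω | idx k ω n = z} = 1 / (Z : ℝ) := by
  have hN : 0 < N := n.pos
  have e : {ω | idx k ω n = z}
      = ⋃ j ∈ Finset.univ.filter fun j : Fin N → Fin Z => j n = z, {ω | idx k ω = j} := by
    ext ω; simp
  have hZ' : (Z : ℝ) ≠ 0 := by positivity
  rw [e, measureReal_def, measure_biUnion_finset]
  · simp only [h.idx_uniform k, Finset.sum_const, card_filter_apply_eq, nsmul_eq_mul]
    obtain ⟨m, rfl⟩ : ∃ m, N = m + 1 := ⟨N - 1, by omega⟩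
    simp only [Nat.add_sub_cancel, ENNReal.toReal_mul, ENNReal.toReal_inv, ENNReal.toReal_pow,
      ENNReal.toReal_natCast, Nat.cast_pow]
    rw [pow_succ]; field_simp
  · intro i _ j _ hij
    exact Set.disjoint_left.2 fun ω hi hj => hij (hi.symm.trans hj)
  · intro j _
    exact 𝓕.le _ _ (h.idx_meas k (measurableSet_singleton j))

/-- The conditional expectation over a uniform draw is the average over the dataset. -/
lemma IsByzantineSetup.integral_draw (h : IsByzantineSetup P 𝓕 D S idx byz) (hZ : 0 < Z) (k : ℕ)
    (n : Fin N) {φ : Fin Z → Ω → ℝ} (hφ : ∀ z, Measurable[𝓕 k] (φ z))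
    (hi : ∀ z, Integrable (φ z) P) :
    ∫ ω, φ (idx k ω n) ω ∂P = ∫ ω, (1 / (Z : ℝ)) * ∑ z, φ z ω ∂P := by
  classical
  -- Splitting over the value of the draw makes each term a product of an indicator of probability
  -- 1/Z and an `𝓕 k`-measurable factor independent of it.
  let χ : Fin Z → Ω → ℝ := fun z ω => if idx k ω n = z then 1 else 0
  have e : ∀ ω, φ (idx k ω n) ω = ∑ z, χ z ω * φ z ω := fun ω => by simp [χ]
  have hset : ∀ z, MeasurableSet {ω | idx k ω n = z} := fun z =>
    𝓕.le _ _ (h.measurable_idx k n (measurableSet_singleton z))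
  have hχm : ∀ z, Measurable (χ z) := fun z =>
    Measurable.ite (hset z) measurable_const measurable_const
  have hχi : ∀ z, Integrable (fun ω => χ z ω * φ z ω) P := fun z =>
    (hi z).bdd_mul (c := 1) (hχm z).aestronglyMeasurable (Filter.Eventually.of_forall fun ω => by
      simp only [χ]; split_ifs <;> simp)
  have hind : ∀ z, IndepFun (χ z) (φ z) P := fun z => by
    rw [IndepFun_iff_Indep]
    refine indep_of_indep_of_le_right (indep_of_indep_of_le_left (h.idx_indep k) ?_)
      (hφ z).comap_le
    have : χ z = (fun j : Fin N → Fin Z => if j n = z then (1 : ℝ) else 0) ∘ idx k := rfl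
    rw [this, ← MeasurableSpace.comap_comp]
    exact MeasurableSpace.comap_mono (measurable_of_finite _).comap_le
  have hχ : ∀ z, ∫ ω, χ z ω ∂P = 1 / (Z : ℝ) := fun z => by
    rw [← h.measure_idx_eq hZ k n z, ← integral_indicator_one (hset z)]
    simp [χ, Set.indicator_apply]
  simp only [e]
  rw [integral_finsetSum _ fun z _ => hχi z, integral_const_mul, integral_finsetSum _ fun z _ => hi z,
    Finset.mul_sum]
  refine Finset.sum_congr rfl fun z _ => ?_
  rw [(hind z).integral_fun_mul_eq_mul_integral (hχm z).aestronglyMeasurable (hi z).1, hχ]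

lemma IsByzantineSetup.measurable_sample (h : IsByzantineSetup P 𝓕 D S idx byz) (k : ℕ)
    (n : Fin N) (z : Fin Z) : Measurable[𝓕 k] fun ω => S ω n z :=
  (h.data_meas n z).mono (𝓕.mono (Nat.zero_le k)) le_rfl

lemma IsByzantineSetup.measurable_drawn (h : IsByzantineSetup P 𝓕 D S idx byz) (k : ℕ)
    (n : Fin N) : Measurable[𝓕 (k + 1)] fun ω => S ω n (idx k ω n) := by
  have h1 : Measurable[Prod.instMeasurableSpace (m₁ := inferInstance) (m₂ := 𝓕 (k + 1))]
      fun p : Fin Z × Ω => S p.2 n p.1 :=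
    @measurable_from_prod_countable_right _ _ _ _ (𝓕 (k + 1)) _ _ _ _
      fun z => h.measurable_sample (k + 1) n z
  exact h1.comp ((h.measurable_idx k n).prodMk measurable_id)

end Draws

/-! ### Moments of the iterates and of the gradient noise. -/

/-- A crude bound by the non-Byzantine models alone. It serves integrability only, so its size is
irrelevant. -/
lemma IsVirtualMixing.norm_aggregate_sub_le {d N B : ℕ} {G : SimpleGraph (Fin N ⊕ Fin B)}
    {A : (n : Fin N) → AggregationRule G d n} {W : Matrix (Fin N) (Fin N) ℝ} {ρ : ℝ}
    (hA : IsVirtualMixing G A W ρ) (hN : 0 < N) (u : Fin N → Model d) (v : Fin B → Model d)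
    (n : Fin N) (c : Model d) :
    ‖A n (u n) (fun m => Sum.elim u v m.1) - c‖ ≤ (2 * ρ + 1) * ∑ m, ‖u m - c‖ := by
  have hN' : (N : ℝ) ≠ 0 := by positivity
  have hρ := hA.rho_nonneg
  set s := ∑ m, ‖u m - c‖
  have hs : 0 ≤ s := Finset.sum_nonneg fun _ _ => norm_nonneg _
  have h1 : ‖A n (u n) (fun m => Sum.elim u v m.1) - ∑ m, W n m • u m‖ ≤ 2 * ρ * s := by
    refine le_of_sq_le_sq ((hA.norm_sub_sq_le hN u v n).trans ?_) (by positivity)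
    have h2 : dispersion u ≤ (1 / (N : ℝ)) * s ^ 2 := by
      refine (_root_.dispersion_le hN u c).trans ?_
      gcongr
      exact Finset.sum_sq_le_sq_sum_of_nonneg fun _ _ => norm_nonneg _
    calc _ ≤ 4 * ρ ^ 2 * N * ((1 / (N : ℝ)) * s ^ 2) := by gcongr
      _ = _ := by field_simp; ring
  have h2 : ‖∑ m, W n m • u m - c‖ ≤ s := by
    have e : ∑ m, W n m • u m - c = ∑ m, W n m • (u m - c) := by
      simp [smul_sub, Finset.sum_sub_distrib, ← Finset.sum_smul, hA.row_sum]
    rw [e]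
    refine (norm_sum_le _ _).trans (Finset.sum_le_sum fun m _ => ?_)
    rw [norm_smul, Real.norm_of_nonneg (hA.weight_mem n m).1]
    exact mul_le_of_le_one_left (norm_nonneg _) (hA.weight_mem n m).2
  have h3 := norm_sub_le_norm_sub_add_norm_sub (A n (u n) (fun m => Sum.elim u v m.1))
    (∑ m, W n m • u m) c
  linarith

/-- The standing hypotheses on a run of Byzantine-resilient DSGD, with the minimizer `xs` of the
empirical loss chosen as a measurable function of the dataset. -/
structure IsDsgdRun {N B Z d : ℕ} {Ξ Ω : Type*} [MeasurableSpace Ξ] {mΩ : MeasurableSpace Ω}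
    (f : Model d → Ξ → ℝ) (G : SimpleGraph (Fin N ⊕ Fin B))
    (A : (n : Fin N) → AggregationRule G d n) (W : Matrix (Fin N) (Fin N) ℝ)
    (μ L lam ρ : ℝ) (α : ℕ → ℝ) (x₀ : Model d) (P : Measure Ω) (𝓕 : Filtration ℕ mΩ)
    (D : Fin N → Measure Ξ) (S : Ω → Fin N → Fin Z → Ξ) (idx : ℕ → Ω → Fin N → Fin Z)
    (byz : ℕ → Fin B → Fin N → Ω → Model d) (σ δ : ℝ) (xs : Ω → Model d)
    (x : ℕ → Ω → Fin N → Model d) : Prop where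
  N_pos : 0 < N
  Z_pos : 0 < Z
  mu_pos : 0 < μ
  L_pos : 0 < L
  lam_pos : 0 < lam
  agg_meas : ∀ n, Measurable fun p : Model d × (G.neighborSet (Sum.inl n) → Model d) =>
    A n p.1 p.2
  mixing : IsVirtualMixing G A W ρ
  gap : mixingGap W = lam
  rho_lt : ρ < lam / (8 * √(N : ℝ))
  prob : IsProbabilityMeasure P
  setup : IsByzantineSetup P 𝓕 D S idx byz
  loss_meas : ∀ x, Measurable (f x)
  convex : StronglyConvexLoss f μ
  smooth : SmoothLoss f L
  noise : ∀ᵐ ω ∂P, BoundedNoise f (S ω) σ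
  het : ∀ᵐ ω ∂P, BoundedHeterogeneity f (S ω) δ
  xs_meas : Measurable[𝓕 0] xs
  xs_zero : ∀ ω, empiricalGrad f (S ω) (xs ω) = 0
  memLp_init : MemLp (fun ω => x₀ - xs ω) 2 P
  x_eq : x = dsgd f G A α x₀ S idx byz

namespace IsDsgdRun

variable {N B Z d : ℕ} {Ξ Ω : Type*} [MeasurableSpace Ξ] {mΩ : MeasurableSpace Ω}
  {f : Model d → Ξ → ℝ} {G : SimpleGraph (Fin N ⊕ Fin B)}
  {A : (n : Fin N) → AggregationRule G d n} {W : Matrix (Fin N) (Fin N) ℝ}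
  {μ L lam ρ : ℝ} {α : ℕ → ℝ} {x₀ : Model d} {P : Measure Ω} {𝓕 : Filtration ℕ mΩ}
  {D : Fin N → Measure Ξ} {S : Ω → Fin N → Fin Z → Ξ} {idx : ℕ → Ω → Fin N → Fin Z}
  {byz : ℕ → Fin B → Fin N → Ω → Model d} {σ δ : ℝ} {xs : Ω → Model d}
  {x : ℕ → Ω → Fin N → Model d}

lemma x_zero (R : IsDsgdRun f G A W μ L lam ρ α x₀ P 𝓕 D S idx byz σ δ xs x) (ω : Ω) (n : Fin N) :
    x 0 ω n = x₀ := by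
  rw [R.x_eq]; rfl

lemma x_succ (R : IsDsgdRun f G A W μ L lam ρ α x₀ P 𝓕 D S idx byz σ δ xs x) (k : ℕ) (ω : Ω) :
    x (k + 1) ω = fun n => A n (halfStep f (S ω) (α k) (idx k ω) (x k ω) n)
      (fun m => Sum.elim (halfStep f (S ω) (α k) (idx k ω) (x k ω))
        (fun b => byz k b n ω) m.1) := by
  rw [R.x_eq]; rfl

lemma measurable_lossGrad_comp
    (R : IsDsgdRun f G A W μ L lam ρ α x₀ P 𝓕 D S idx byz σ δ xs x) {m : MeasurableSpace Ω}
    {ξ : Ω → Ξ} {y : Ω → Model d} (hξ : Measurable[m] ξ) (hy : Measurable[m] y) :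
    Measurable[m] fun ω => lossGrad f (ξ ω) (y ω) :=
  (R.convex.measurable_uncurry_lossGrad R.smooth R.L_pos.le R.loss_meas).comp (hy.prodMk hξ)

lemma measurable_localGrad_comp
    (R : IsDsgdRun f G A W μ L lam ρ α x₀ P 𝓕 D S idx byz σ δ xs x) {k : ℕ}
    {y : Ω → Model d} (n : Fin N) (hy : Measurable[𝓕 k] y) :
    Measurable[𝓕 k] fun ω => localGrad f (S ω n) (y ω) :=
  (Finset.measurable_sum _ fun z _ =>
    R.measurable_lossGrad_comp (R.setup.measurable_sample k n z) hy).const_smul (1 / (Z : ℝ))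

lemma measurable_halfStep
    (R : IsDsgdRun f G A W μ L lam ρ α x₀ P 𝓕 D S idx byz σ δ xs x) {k : ℕ}
    (h : ∀ n, Measurable[𝓕 k] fun ω => x k ω n) (n : Fin N) :
    Measurable[𝓕 (k + 1)] fun ω => halfStep f (S ω) (α k) (idx k ω) (x k ω) n := by
  have hx := (h n).mono (𝓕.mono (Nat.le_succ k)) le_rfl
  exact hx.sub ((R.measurable_lossGrad_comp (R.setup.measurable_drawn k n) hx).const_smul (α k))

lemma measurable_x (R : IsDsgdRun f G A W μ L lam ρ α x₀ P 𝓕 D S idx byz σ δ xs x) (k : ℕ)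
    (n : Fin N) : Measurable[𝓕 k] fun ω => x k ω n := by
  induction k generalizing n with
  | zero => simp only [R.x_zero]; exact measurable_const
  | succ k ih =>
    simp only [R.x_succ]
    refine (R.agg_meas n).comp ((R.measurable_halfStep ih n).prodMk ?_)
    refine @measurable_pi_lambda _ _ _ (𝓕 (k + 1)) _ _ fun m => ?_
    rcases m with ⟨m | b, hm⟩
    · exact R.measurable_halfStep ih m
    · exact R.setup.byz_meas k b n

lemma measurable_meanModel_x
    (R : IsDsgdRun f G A W μ L lam ρ α x₀ P 𝓕 D S idx byz σ δ xs x) (k : ℕ) :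
    Measurable[𝓕 k] fun ω => meanModel (x k ω) :=
  (Finset.measurable_sum _ fun n _ => R.measurable_x k n).const_smul (1 / (N : ℝ))

/-- The empirical gradient vanishes at `xs`, so noise and heterogeneity bound the mean square of all
sample gradients there; a single one is at most N Z times the mean. This provides square integrable
gradients without a separate moment assumption, and the factor N Z never enters a rate. -/
lemma ae_norm_lossGrad_le (R : IsDsgdRun f G A W μ L lam ρ α x₀ P 𝓕 D S idx byz σ δ xs x) :
    ∀ᵐ ω ∂P, ∀ n z, ‖lossGrad f (S ω n z) (xs ω)‖ ≤ √(N * Z * (σ ^ 2 + δ ^ 2)) := by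
  filter_upwards [R.noise, R.het] with ω h1 h2 n z
  have hN := R.N_pos
  have hZ := R.Z_pos
  have h := mean_norm_lossGrad_sub_le R.convex R.Z_pos R.N_pos h1 h2 (xs ω)
  rw [R.xs_zero ω] at h
  simp only [sub_zero] at h
  refine Real.le_sqrt_of_sq_le ?_
  have h3 : ‖lossGrad f (S ω n z) (xs ω)‖ ^ 2 ≤ ∑ n, ∑ z, ‖lossGrad f (S ω n z) (xs ω)‖ ^ 2 := by
    refine (Finset.single_le_sum (f := fun z => ‖lossGrad f (S ω n z) (xs ω)‖ ^ 2)
      (fun _ _ => by positivity) (Finset.mem_univ z)).trans ?_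
    exact Finset.single_le_sum (f := fun n => ∑ z, ‖lossGrad f (S ω n z) (xs ω)‖ ^ 2)
      (fun _ _ => by positivity) (Finset.mem_univ n)
  refine h3.trans ?_
  rw [← Finset.mul_sum, one_div_mul_eq_div, one_div_mul_eq_div, div_div, div_le_iff₀ (by positivity)]
    at h
  linarith

/-- Lipschitz comparison with the gradient at `xs`. The sample may be picked by a random index,
which covers both fixed and drawn samples. -/
lemma memLp_lossGrad (R : IsDsgdRun f G A W μ L lam ρ α x₀ P 𝓕 D S idx byz σ δ xs x) {ξ : Ω → Ξ}
    {y : Ω → Model d} (hξ : Measurable ξ) {n : Fin N} (hξS : ∀ ω, ∃ z, ξ ω = S ω n z)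
    (hy : Measurable y) (hy2 : MemLp (fun ω => y ω - xs ω) 2 P) :
    MemLp (fun ω => lossGrad f (ξ ω) (y ω)) 2 P := by
  have := R.prob
  refine ((hy2.norm.const_mul L).add (memLp_const √(N * Z * (σ ^ 2 + δ ^ 2)))).mono'
    (R.measurable_lossGrad_comp hξ hy).aestronglyMeasurable ?_
  filter_upwards [R.ae_norm_lossGrad_le] with ω hω
  obtain ⟨z, hz⟩ := hξS ω
  have h1 : ‖lossGrad f (ξ ω) (y ω) - lossGrad f (ξ ω) (xs ω)‖ ≤ L * ‖y ω - xs ω‖ :=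
    R.smooth _ _ _
  have h2 := hω n z
  rw [← hz] at h2
  have h3 := norm_le_norm_add_norm_sub' (lossGrad f (ξ ω) (y ω)) (lossGrad f (ξ ω) (xs ω))
  simp only [Pi.add_apply]
  linarith

lemma memLp_localGrad (R : IsDsgdRun f G A W μ L lam ρ α x₀ P 𝓕 D S idx byz σ δ xs x)
    {y : Ω → Model d} (n : Fin N) (hy : Measurable y) (hy2 : MemLp (fun ω => y ω - xs ω) 2 P) :
    MemLp (fun ω => localGrad f (S ω n) (y ω)) 2 P :=
  memLp_meanModel (u := fun ω z => lossGrad f (S ω n z) (y ω)) fun z =>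
    R.memLp_lossGrad ((R.setup.data_meas n z).mono (𝓕.le 0) le_rfl) (fun _ => ⟨z, rfl⟩) hy hy2

lemma memLp_drawnGrad (R : IsDsgdRun f G A W μ L lam ρ α x₀ P 𝓕 D S idx byz σ δ xs x)
    {y : Ω → Model d} (k : ℕ) (n : Fin N) (hy : Measurable y)
    (hy2 : MemLp (fun ω => y ω - xs ω) 2 P) :
    MemLp (fun ω => lossGrad f (S ω n (idx k ω n)) (y ω)) 2 P :=
  R.memLp_lossGrad ((R.setup.measurable_drawn k n).mono (𝓕.le _) le_rfl) (fun _ => ⟨_, rfl⟩) hy hy2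

lemma memLp_halfStep_of (R : IsDsgdRun f G A W μ L lam ρ α x₀ P 𝓕 D S idx byz σ δ xs x) {k : ℕ}
    (h : ∀ n, MemLp (fun ω => x k ω n - xs ω) 2 P) (n : Fin N) :
    MemLp (fun ω => halfStep f (S ω) (α k) (idx k ω) (x k ω) n - xs ω) 2 P := by
  refine ((h n).sub ((R.memLp_drawnGrad k n ((R.measurable_x k n).mono (𝓕.le _) le_rfl)
    (h n)).const_smul (α k))).ae_eq (Filter.Eventually.of_forall fun ω => ?_)
  simp only [Pi.sub_apply, Pi.smul_apply, halfStep, lossGrad]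
  abel

/-- Byzantine messages carry no integrability; the contraction property bounds each aggregate by the
non-Byzantine half steps, which makes the induction work. -/
lemma memLp_x (R : IsDsgdRun f G A W μ L lam ρ α x₀ P 𝓕 D S idx byz σ δ xs x) (k : ℕ)
    (n : Fin N) : MemLp (fun ω => x k ω n - xs ω) 2 P := by
  induction k generalizing n with
  | zero => simpa only [R.x_zero] using R.memLp_init
  | succ k ih =>
    refine ((memLp_finsetSum Finset.univ fun m _ =>
      (R.memLp_halfStep_of ih m).norm).const_mul (2 * ρ + 1)).mono' ?_
      (Filter.Eventually.of_forall fun ω => ?_)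
    · exact (((R.measurable_x (k + 1) n).mono (𝓕.le _) le_rfl).sub
        (R.xs_meas.mono (𝓕.le _) le_rfl)).aestronglyMeasurable
    · rw [R.x_succ]
      exact R.mixing.norm_aggregate_sub_le R.N_pos _ _ n _

lemma memLp_halfStep (R : IsDsgdRun f G A W μ L lam ρ α x₀ P 𝓕 D S idx byz σ δ xs x) (k : ℕ)
    (n : Fin N) : MemLp (fun ω => halfStep f (S ω) (α k) (idx k ω) (x k ω) n - xs ω) 2 P :=
  R.memLp_halfStep_of (R.memLp_x k) n

/-- The gradient noise of a draw at a point that is known before the draw. -/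
lemma integral_noise_le (R : IsDsgdRun f G A W μ L lam ρ α x₀ P 𝓕 D S idx byz σ δ xs x) (k : ℕ)
    (n : Fin N) {y : Ω → Model d} (hy : Measurable[𝓕 k] y)
    (hy2 : MemLp (fun ω => y ω - xs ω) 2 P) :
    ∫ ω, ‖lossGrad f (S ω n (idx k ω n)) (y ω) - localGrad f (S ω n) (y ω)‖ ^ 2 ∂P ≤ σ ^ 2 := by
  have := R.prob
  have hy' : Measurable y := hy.mono (𝓕.le _) le_rfl
  have hint : ∀ z, Integrable
      (fun ω => ‖lossGrad f (S ω n z) (y ω) - localGrad f (S ω n) (y ω)‖ ^ 2) P := fun z =>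
    ((R.memLp_lossGrad ((R.setup.data_meas n z).mono (𝓕.le 0) le_rfl) (fun _ => ⟨z, rfl⟩) hy'
      hy2).sub (R.memLp_localGrad n hy' hy2)).integrable_norm_sq
  rw [R.setup.integral_draw R.Z_pos k n
    (φ := fun z ω => ‖lossGrad f (S ω n z) (y ω) - localGrad f (S ω n) (y ω)‖ ^ 2)
    (fun z => (measurable_norm.comp
      ((R.measurable_lossGrad_comp (R.setup.measurable_sample k n z) hy).sub
        (R.measurable_localGrad_comp n hy))).pow_const 2) hint]
  calc _ ≤ ∫ _ω, σ ^ 2 ∂P := by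
        refine integral_mono_ae ((integrable_finsetSum _ fun z _ => hint z).const_mul _)
          (integrable_const _) ?_
        filter_upwards [R.noise] with ω hω
        have := hω (y ω) n
        rwa [(R.convex.hasGradientAt_localLoss _ _).gradient] at this
    _ = σ ^ 2 := by simp

/-- The gradient noise of a draw is uncorrelated with what is known before the draw. -/
lemma integral_inner_noise (R : IsDsgdRun f G A W μ L lam ρ α x₀ P 𝓕 D S idx byz σ δ xs x) (k : ℕ)
    (n : Fin N) {y v : Ω → Model d} (hy : Measurable[𝓕 k] y)
    (hy2 : MemLp (fun ω => y ω - xs ω) 2 P) (hv : Measurable[𝓕 k] v) (hv2 : MemLp v 2 P) :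
    ∫ ω, inner ℝ (lossGrad f (S ω n (idx k ω n)) (y ω) - localGrad f (S ω n) (y ω)) (v ω) ∂P
      = 0 := by
  have hy' : Measurable y := hy.mono (𝓕.le _) le_rfl
  rw [R.setup.integral_draw R.Z_pos k n
    (φ := fun z ω => inner ℝ (lossGrad f (S ω n z) (y ω) - localGrad f (S ω n) (y ω)) (v ω))
    (fun z => ((R.measurable_lossGrad_comp (R.setup.measurable_sample k n z) hy).sub
      (R.measurable_localGrad_comp n hy)).inner hv) fun z =>
    ((R.memLp_lossGrad ((R.setup.data_meas n z).mono (𝓕.le 0) le_rfl) (fun _ => ⟨z, rfl⟩) hy'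
      hy2).sub (R.memLp_localGrad n hy' hy2)).integrable_inner_two hv2]
  have : ∀ ω, (1 / (Z : ℝ)) * ∑ z, inner ℝ (lossGrad f (S ω n z) (y ω) - localGrad f (S ω n) (y ω))
      (v ω) = 0 := fun ω => by
    rw [← inner_meanModel_left, meanModel_sub, meanModel_const R.Z_pos, localGrad, sub_self,
      inner_zero_left]
  simp only [this, integral_zero]

end IsDsgdRun

/-! ### One-step inequalities in expectation. -/

namespace IsDsgdRun

variable {N B Z d : ℕ} {Ξ Ω : Type*} [MeasurableSpace Ξ] {mΩ : MeasurableSpace Ω}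
  {f : Model d → Ξ → ℝ} {G : SimpleGraph (Fin N ⊕ Fin B)}
  {A : (n : Fin N) → AggregationRule G d n} {W : Matrix (Fin N) (Fin N) ℝ}
  {μ L lam ρ : ℝ} {α : ℕ → ℝ} {x₀ : Model d} {P : Measure Ω} {𝓕 : Filtration ℕ mΩ}
  {D : Fin N → Measure Ξ} {S : Ω → Fin N → Fin Z → Ξ} {idx : ℕ → Ω → Fin N → Fin Z}
  {byz : ℕ → Fin B → Fin N → Ω → Model d} {σ δ : ℝ} {xs : Ω → Model d}
  {x : ℕ → Ω → Fin N → Model d}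

lemma integrable_dispersion_x (R : IsDsgdRun f G A W μ L lam ρ α x₀ P 𝓕 D S idx byz σ δ xs x)
    (k : ℕ) : Integrable (fun ω => dispersion (x k ω)) P :=
  integrable_dispersion R.N_pos (R.memLp_x k)

lemma integrable_dispersion_halfStep
    (R : IsDsgdRun f G A W μ L lam ρ α x₀ P 𝓕 D S idx byz σ δ xs x) (k : ℕ) :
    Integrable (fun ω => dispersion (halfStep f (S ω) (α k) (idx k ω) (x k ω))) P :=
  integrable_dispersion R.N_pos (R.memLp_halfStep k)

lemma memLp_meanModel_x (R : IsDsgdRun f G A W μ L lam ρ α x₀ P 𝓕 D S idx byz σ δ xs x) (k : ℕ) :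
    MemLp (fun ω => meanModel (x k ω) - xs ω) 2 P :=
  memLp_meanModel_sub R.N_pos (R.memLp_x k)

/-- The contraction holds for every outcome and arbitrary messages, so messages depending on the
current draws are covered. -/
lemma integral_dispersion_succ_le
    (R : IsDsgdRun f G A W μ L lam ρ α x₀ P 𝓕 D S idx byz σ δ xs x) (k : ℕ) :
    ∫ ω, dispersion (x (k + 1) ω) ∂P
      ≤ (1 - lam / 4) * ∫ ω, dispersion (halfStep f (S ω) (α k) (idx k ω) (x k ω)) ∂P := by
  rw [← integral_const_mul]
  refine integral_mono (R.integrable_dispersion_x _)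
    ((R.integrable_dispersion_halfStep k).const_mul _) fun ω => ?_
  simp only [R.x_succ]
  exact R.mixing.dispersion_le R.N_pos R.lam_pos R.gap R.rho_lt _ (fun n b => byz k b n ω)

lemma integral_dispersion_halfStep_le
    (R : IsDsgdRun f G A W μ L lam ρ α x₀ P 𝓕 D S idx byz σ δ xs x) {k : ℕ}
    (hα : (1 + 16 / lam) * (3 * α k ^ 2 * L ^ 2) ≤ lam / 16) :
    ∫ ω, dispersion (halfStep f (S ω) (α k) (idx k ω) (x k ω)) ∂P
      ≤ (1 + lam / 8) * ∫ ω, dispersion (x k ω) ∂P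
        + 3 * (1 + 16 / lam) * α k ^ 2 * (σ ^ 2 + δ ^ 2) := by
  have := R.prob
  have hlam := R.lam_pos
  have hN : (N : ℝ) ≠ 0 := by have := R.N_pos; positivity
  have hy := R.measurable_meanModel_x k
  have hy2 := R.memLp_meanModel_x k
  have hn2 : ∀ n, MemLp (fun ω => lossGrad f (S ω n (idx k ω n)) (meanModel (x k ω))
      - localGrad f (S ω n) (meanModel (x k ω))) 2 P := fun n =>
    (R.memLp_drawnGrad k n (hy.mono (𝓕.le _) le_rfl) hy2).sub
      (R.memLp_localGrad n (hy.mono (𝓕.le _) le_rfl) hy2)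
  have hni : Integrable (fun ω => noiseAt f (S ω) (idx k ω) (meanModel (x k ω))) P :=
    integrable_mean_norm_sq (u := fun ω n => lossGrad f (S ω n (idx k ω n)) (meanModel (x k ω))
      - localGrad f (S ω n) (meanModel (x k ω))) hn2
  have hnoise : ∫ ω, noiseAt f (S ω) (idx k ω) (meanModel (x k ω)) ∂P ≤ σ ^ 2 := by
    simp only [noiseAt]
    rw [integral_const_mul, integral_finsetSum _ fun n _ => (hn2 n).integrable_norm_sq]
    calc _ ≤ (1 / (N : ℝ)) * ∑ _n : Fin N, σ ^ 2 := by
          gcongr with n; exact R.integral_noise_le k n hy hy2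
      _ = _ := by simp [hN]
  calc _ ≤ ∫ ω, ((1 + lam / 8) * dispersion (x k ω) + 3 * (1 + 16 / lam) * α k ^ 2
        * (noiseAt f (S ω) (idx k ω) (meanModel (x k ω)) + δ ^ 2)) ∂P := by
        refine integral_mono_ae (R.integrable_dispersion_halfStep k)
          (((R.integrable_dispersion_x k).const_mul _).add
            ((hni.add (integrable_const _)).const_mul _)) ?_
        filter_upwards [R.het] with ω hω
        exact dispersion_halfStep_le R.convex R.smooth R.N_pos hω hlam hα _ _
    _ = (1 + lam / 8) * ∫ ω, dispersion (x k ω) ∂P + 3 * (1 + 16 / lam) * α k ^ 2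
        * (∫ ω, noiseAt f (S ω) (idx k ω) (meanModel (x k ω)) ∂P + δ ^ 2) := by
        have i1 : Integrable (fun ω => noiseAt f (S ω) (idx k ω) (meanModel (x k ω)) + δ ^ 2) P :=
          hni.add (integrable_const _)
        rw [integral_add ((R.integrable_dispersion_x k).const_mul _) (i1.const_mul _),
          integral_const_mul, integral_const_mul,
          integral_add hni (integrable_const _)]
        simp
    _ ≤ _ := by gcongr

/-- The gradient step decreases the mean square distance of the average model to the minimizer. -/
lemma integral_meanModel_halfStep_le
    (R : IsDsgdRun f G A W μ L lam ρ α x₀ P 𝓕 D S idx byz σ δ xs x) {k : ℕ} (hα : 0 ≤ α k)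
    (hαL : α k * L ^ 2 ≤ μ) {τ : ℝ} (hτ : 0 < τ) :
    ∫ ω, ‖meanModel (halfStep f (S ω) (α k) (idx k ω) (x k ω)) - xs ω‖ ^ 2 ∂P
      ≤ (1 + τ) * (1 - α k * μ) * ∫ ω, ‖meanModel (x k ω) - xs ω‖ ^ 2 ∂P
        + (1 + 1 / τ) * (α k ^ 2 * L ^ 2 * ∫ ω, dispersion (x k ω) ∂P) + α k ^ 2 * σ ^ 2 := by
  have hN : (N : ℝ) ≠ 0 := by have := R.N_pos; positivity
  have hx := R.measurable_x k
  have hx' : ∀ n, Measurable fun ω => x k ω n := fun n => (hx n).mono (𝓕.le _) le_rfl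
  have hx2 := R.memLp_x k
  -- `v` is the step with exact local gradients and is `𝓕 k`-measurable; `w` is the draw noise.
  -- Their cross term vanishes in expectation.
  set v : Ω → Model d := fun ω =>
    meanModel (x k ω) - xs ω - α k • meanModel (fun n => localGrad f (S ω n) (x k ω n))
  set w : Fin N → Ω → Model d := fun n ω =>
    lossGrad f (S ω n (idx k ω n)) (x k ω n) - localGrad f (S ω n) (x k ω n)
  have hvm : Measurable[𝓕 k] v :=
    ((R.measurable_meanModel_x k).sub (R.xs_meas.mono (𝓕.mono (Nat.zero_le k)) le_rfl)).sub
      (((Finset.measurable_sum _ fun n _ =>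
        R.measurable_localGrad_comp n (hx n)).const_smul (1 / (N : ℝ))).const_smul (α k))
  have hv2 : MemLp v 2 P := (R.memLp_meanModel_x k).sub
    ((memLp_meanModel (u := fun ω n => localGrad f (S ω n) (x k ω n)) fun n =>
      R.memLp_localGrad n (hx' n) (hx2 n)).const_smul (α k))
  have hw2 : ∀ n, MemLp (w n) 2 P := fun n =>
    (R.memLp_drawnGrad k n (hx' n) (hx2 n)).sub (R.memLp_localGrad n (hx' n) (hx2 n))
  have hwm2 : MemLp (fun ω => meanModel (fun n => w n ω)) 2 P :=
    memLp_meanModel (u := fun ω n => w n ω) hw2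
  have hsplit : ∀ ω, ‖meanModel (halfStep f (S ω) (α k) (idx k ω) (x k ω)) - xs ω‖ ^ 2
      = ‖v ω‖ ^ 2 - 2 * α k * inner ℝ (meanModel (fun n => w n ω)) (v ω)
        + α k ^ 2 * ‖meanModel (fun n => w n ω)‖ ^ 2 := fun ω => by
    have e : meanModel (halfStep f (S ω) (α k) (idx k ω) (x k ω)) - xs ω
        = v ω - α k • meanModel (fun n => w n ω) := by
      have e1 : halfStep f (S ω) (α k) (idx k ω) (x k ω)
          = fun n => x k ω n - α k • lossGrad f (S ω n (idx k ω n)) (x k ω n) := rfl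
      simp only [v, w, e1, meanModel_sub, meanModel_smul]
      module
    rw [e, norm_sub_sq_real, inner_smul_right, norm_smul, mul_pow, Real.norm_eq_abs, sq_abs,
      real_inner_comm]
    ring
  have hcross : ∫ ω, inner ℝ (meanModel (fun n => w n ω)) (v ω) ∂P = 0 := by
    simp only [inner_meanModel_left]
    rw [integral_const_mul, integral_finsetSum _ fun n _ => (hw2 n).integrable_inner_two hv2]
    simp only [w, fun n => R.integral_inner_noise k n (hx n) (hx2 n) hvm hv2,
      Finset.sum_const_zero, mul_zero]
  -- Jensen over the agents suffices. Independence between agents would improve this to σ²/N, but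
  -- with k of order μNZ the term α²σ² already leads to σ²/(μNZ).
  have hvar : ∫ ω, ‖meanModel (fun n => w n ω)‖ ^ 2 ∂P ≤ σ ^ 2 := by
    calc _ ≤ ∫ ω, (1 / (N : ℝ)) * ∑ n, ‖w n ω‖ ^ 2 ∂P :=
          integral_mono hwm2.integrable_norm_sq
            (integrable_mean_norm_sq (u := fun ω n => w n ω) hw2)
            fun ω => norm_meanModel_sq_le R.N_pos _
      _ = (1 / (N : ℝ)) * ∑ n, ∫ ω, ‖w n ω‖ ^ 2 ∂P := by
          rw [integral_const_mul, integral_finsetSum _ fun n _ => (hw2 n).integrable_norm_sq]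
      _ ≤ (1 / (N : ℝ)) * ∑ _n : Fin N, σ ^ 2 := by
          gcongr with n; exact R.integral_noise_le k n (hx n) (hx2 n)
      _ = _ := by simp [hN]
  have hdrift : ∫ ω, ‖v ω‖ ^ 2 ∂P
      ≤ (1 + τ) * (1 - α k * μ) * ∫ ω, ‖meanModel (x k ω) - xs ω‖ ^ 2 ∂P
        + (1 + 1 / τ) * (α k ^ 2 * L ^ 2 * ∫ ω, dispersion (x k ω) ∂P) := by
    simp only [← integral_const_mul]
    have i1 := (R.memLp_meanModel_x k).integrable_norm_sq.const_mul ((1 + τ) * (1 - α k * μ))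
    have i2 := ((R.integrable_dispersion_x k).const_mul (α k ^ 2 * L ^ 2)).const_mul (1 + 1 / τ)
    rw [← integral_add i1 i2]
    exact integral_mono hv2.integrable_norm_sq (i1.add i2) fun ω =>
      norm_meanStep_sub_sq_le R.convex R.smooth R.N_pos R.Z_pos (R.xs_zero ω) hα hαL hτ _
  simp only [hsplit]
  have i3 := (hwm2.integrable_inner_two hv2).const_mul (2 * α k)
  have i4 : Integrable (fun ω => ‖v ω‖ ^ 2
      - 2 * α k * inner ℝ (meanModel (fun n => w n ω)) (v ω)) P := hv2.integrable_norm_sq.sub i3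
  rw [integral_add i4 (hwm2.integrable_norm_sq.const_mul _),
    integral_sub hv2.integrable_norm_sq i3, integral_const_mul, integral_const_mul, hcross,
    mul_zero, sub_zero]
  gcongr

/-- The aggregation displacement can be correlated with the position and the draws, so it does not
average out; Young's inequality charges it the factor 1 + 1/τ. -/
lemma integral_meanModel_succ_le
    (R : IsDsgdRun f G A W μ L lam ρ α x₀ P 𝓕 D S idx byz σ δ xs x) {k : ℕ} (hα : 0 ≤ α k)
    (hαL : α k * L ^ 2 ≤ μ) {τ : ℝ} (hτ : 0 < τ) :
    ∫ ω, ‖meanModel (x (k + 1) ω) - xs ω‖ ^ 2 ∂P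
      ≤ (1 + τ) * ((1 + τ) * (1 - α k * μ) * ∫ ω, ‖meanModel (x k ω) - xs ω‖ ^ 2 ∂P
        + (1 + 1 / τ) * (α k ^ 2 * L ^ 2 * ∫ ω, dispersion (x k ω) ∂P) + α k ^ 2 * σ ^ 2)
        + (1 + 1 / τ) * (2 * (4 * ρ ^ 2 * N + chiSq W)
          * ∫ ω, dispersion (halfStep f (S ω) (α k) (idx k ω) (x k ω)) ∂P) := by
  refine le_trans ?_ (add_le_add_left (mul_le_mul_of_nonneg_left
    (R.integral_meanModel_halfStep_le hα hαL hτ) (by positivity)) _)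
  simp only [← integral_const_mul (2 * (4 * ρ ^ 2 * N + chiSq W))]
  rw [← integral_const_mul, ← integral_const_mul]
  have i1 := (memLp_meanModel_sub R.N_pos (R.memLp_halfStep k)).integrable_norm_sq.const_mul (1 + τ)
  have i2 := ((R.integrable_dispersion_halfStep k).const_mul
    (2 * (4 * ρ ^ 2 * N + chiSq W))).const_mul (1 + 1 / τ)
  rw [← integral_add i1 i2]
  refine integral_mono (R.memLp_meanModel_x _).integrable_norm_sq (i1.add i2) fun ω => ?_
  simp only [R.x_succ]
  have h := R.mixing.norm_meanModel_sub_sq_le R.N_pos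
    (halfStep f (S ω) (α k) (idx k ω) (x k ω)) (fun n b => byz k b n ω)
  set a := meanModel (halfStep f (S ω) (α k) (idx k ω) (x k ω))
  have e : meanModel (fun n => A n (halfStep f (S ω) (α k) (idx k ω) (x k ω) n)
      (fun m => Sum.elim (halfStep f (S ω) (α k) (idx k ω) (x k ω)) (fun b => byz k b n ω) m.1))
      - xs ω = (a - xs ω) + (meanModel (fun n => A n (halfStep f (S ω) (α k) (idx k ω) (x k ω) n)
      (fun m => Sum.elim (halfStep f (S ω) (α k) (idx k ω) (x k ω)) (fun b => byz k b n ω) m.1))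
      - a) := by abel
  rw [e]
  refine (norm_add_sq_le_young _ _ hτ).trans ?_
  gcongr

end IsDsgdRun

/-! ### Two scalar recursions. -/

section Recursions

/-- A geometric contraction, at least as strong as 1 - λ/8, tracks a slowly varying forcing.
Inserting the ansatz with constant 16D/λ absorbs the forcing at the cost of half the contraction.
The remaining factor 1 - λ/16 covers the passage from 1/m² to 1/(m + 1)², because λm ≥ 32. -/
lemma le_div_sq_of_recursion {u : ℕ → ℝ} {lam D k₁ : ℝ} (hlam : 0 < lam) (hlam1 : lam ≤ 1)
    (hD : 0 ≤ D) (hk : 32 / lam ≤ k₁) (h0 : u 0 ≤ 0) (hu : ∀ k, 0 ≤ u k)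
    (h : ∀ k : ℕ, u (k + 1) ≤ (1 - lam / 4) * ((1 + lam / 8) * u k + D / (k + k₁) ^ 2)) (k : ℕ) :
    u k ≤ 16 * D / lam / (k + k₁) ^ 2 := by
  have hk0 : 0 < k₁ := lt_of_lt_of_le (by positivity) hk
  rw [div_le_iff₀ hlam] at hk
  induction k with
  | zero => exact h0.trans (by positivity)
  | succ k ih =>
    have hm : 0 < (k : ℝ) + k₁ := by positivity
    push_cast
    rw [show (k : ℝ) + 1 + k₁ = (k + k₁) + 1 by ring]
    have hkm : k₁ ≤ k + k₁ := by simp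
    set m := (k : ℝ) + k₁
    have h32 : 32 ≤ m * lam := hk.trans (by gcongr)
    have h1 : u (k + 1) ≤ (1 - lam / 8) * u k + D / m ^ 2 := by
      have hDm : 0 ≤ D / m ^ 2 := by positivity
      nlinarith [h k, hu k, mul_nonneg (sq_nonneg lam) (hu k), mul_nonneg hlam.le hDm]
    have h2 : (1 - lam / 8) * u k + D / m ^ 2 ≤ 16 * D / lam * ((1 - lam / 16) / m ^ 2) := by
      calc _ ≤ (1 - lam / 8) * (16 * D / lam / m ^ 2) + D / m ^ 2 := by
            gcongr; linarith
        _ = _ := by field_simp; ring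
    refine (h1.trans h2).trans ?_
    rw [div_eq_mul_one_div _ ((m + 1) ^ 2)]
    refine mul_le_mul_of_nonneg_left ?_ (by positivity)
    rw [div_le_div_iff₀ (by positivity) (by positivity)]
    nlinarith [mul_le_mul_of_nonneg_right h32 hm.le]

/-- The contraction constant 3/2 exceeds 1, so q/m is reproduced with surplus q/(2m²), which absorbs
a/m² once q ≥ 2a and leaves no logarithm. The forcing b/m is balanced by the constant b, with b/(2m)
to spare. -/
lemma le_div_add_of_recursion {r : ℕ → ℝ} {a b k₁ : ℝ} (ha : 0 ≤ a) (hb : 0 ≤ b) (hk : 2 ≤ k₁)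
    (hr : 0 ≤ r 0)
    (h : ∀ k : ℕ, r (k + 1) ≤ (1 - 3 / 2 / (k + k₁)) * r k + a / (k + k₁) ^ 2 + b / (k + k₁))
    (k : ℕ) : r k ≤ (k₁ * r 0 + 2 * a) / (k + k₁) + b := by
  have hk0 : 0 < k₁ := by linarith
  induction k with
  | zero =>
    have : r 0 ≤ (k₁ * r 0 + 2 * a) / k₁ := by
      rw [le_div_iff₀ hk0]; linarith
    simp only [Nat.cast_zero, zero_add]
    linarith
  | succ k ih =>
    have hm : 2 ≤ (k : ℝ) + k₁ := by
      have : (0 : ℝ) ≤ k := by positivity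
      linarith
    have h1 := h k
    push_cast
    rw [show (k : ℝ) + 1 + k₁ = (k + k₁) + 1 by ring]
    set m := (k : ℝ) + k₁
    have hm0 : 0 < m := by linarith
    set q := k₁ * r 0 + 2 * a with hq
    have hqa : 2 * a ≤ q := by
      have : 0 ≤ k₁ * r 0 := by positivity
      linarith
    have hc : 0 ≤ 1 - 3 / 2 / m := by
      rw [sub_nonneg, div_le_one hm0]; linarith
    refine (h1.trans (add_le_add_left (add_le_add_left (mul_le_mul_of_nonneg_left ih hc) _) _)).trans ?_
    have e : q / (m + 1) + b - ((1 - 3 / 2 / m) * (q / m + b) + a / m ^ 2 + b / m)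
        = ((q - 2 * a) * (m + 1) + 2 * q) / (2 * m ^ 2 * (m + 1)) + b / (2 * m) := by
      field_simp; ring
    have : 0 ≤ ((q - 2 * a) * (m + 1) + 2 * q) / (2 * m ^ 2 * (m + 1)) + b / (2 * m) := by
      have h3 : 0 ≤ q - 2 * a := by linarith
      have h4 : 0 ≤ q := by linarith
      positivity
    linarith

end Recursions

/-! ### Constants and convergence rates. -/

/-- A lower bound on the shift `k₁` of the step sizes `2 / (μ (k + k₁))`. -/
noncomputable def shiftThreshold (μ L lam : ℝ) : ℝ :=
  2 + 32 / lam + 2 * L ^ 2 / μ ^ 2 + (1 + 16 / lam) * (192 * L ^ 2 / (μ ^ 2 * lam))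

/-- The constant in the bound on the dispersion after the gradient step. -/
noncomputable def dispersionConst (μ lam : ℝ) : ℝ :=
  12 * (1 + 16 / lam) / μ ^ 2

/-- The constant in the convergence rate of the average model. -/
noncomputable def rateConst (μ L lam : ℝ) : ℝ :=
  2 * (72 * L ^ 2 * (16 * dispersionConst μ lam / lam) / μ ^ 2 + 8 / μ ^ 2)
    + 18 * (2 * (16 * dispersionConst μ lam / lam) + dispersionConst μ lam)

lemma rateConst_pos {μ L lam : ℝ} (hμ : 0 < μ) (hlam : 0 < lam) : 0 < rateConst μ L lam := by
  unfold rateConst dispersionConst; positivity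

lemma mixingGap_le_one {N : ℕ} (W : Matrix (Fin N) (Fin N) ℝ) : mixingGap W ≤ 1 := by
  unfold mixingGap; exact sub_le_self _ (sq_nonneg _)

lemma chiSq_nonneg {N : ℕ} (W : Matrix (Fin N) (Fin N) ℝ) : 0 ≤ chiSq W := by
  unfold chiSq; positivity

namespace IsDsgdRun

variable {N B Z d : ℕ} {Ξ Ω : Type*} [MeasurableSpace Ξ] {mΩ : MeasurableSpace Ω}
  {f : Model d → Ξ → ℝ} {G : SimpleGraph (Fin N ⊕ Fin B)}
  {A : (n : Fin N) → AggregationRule G d n} {W : Matrix (Fin N) (Fin N) ℝ}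
  {μ L lam ρ k₁ : ℝ} {x₀ : Model d} {P : Measure Ω} {𝓕 : Filtration ℕ mΩ}
  {D : Fin N → Measure Ξ} {S : Ω → Fin N → Fin Z → Ξ} {idx : ℕ → Ω → Fin N → Fin Z}
  {byz : ℕ → Fin B → Fin N → Ω → Model d} {σ δ : ℝ} {xs : Ω → Model d}
  {x : ℕ → Ω → Fin N → Model d}

lemma integral_dispersion_rate
    (R : IsDsgdRun f G A W μ L lam ρ (fun k => 2 / (μ * (k + k₁))) x₀ P 𝓕 D S idx byz σ δ xs x)
    (hk₁ : shiftThreshold μ L lam ≤ k₁) (k : ℕ) :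
    ∫ ω, dispersion (x k ω) ∂P
        ≤ 16 * dispersionConst μ lam / lam * (σ ^ 2 + δ ^ 2) / (k + k₁) ^ 2 ∧
      ∫ ω, dispersion (halfStep f (S ω) (2 / (μ * (k + k₁))) (idx k ω) (x k ω)) ∂P
        ≤ (2 * (16 * dispersionConst μ lam / lam) + dispersionConst μ lam) * (σ ^ 2 + δ ^ 2)
          / (k + k₁) ^ 2 := by
  have hμ := R.mu_pos
  have hL := R.L_pos
  have hlam := R.lam_pos
  have hlam1 : lam ≤ 1 := R.gap ▸ mixingGap_le_one W
  have ht1 : 0 < 32 / lam := by positivity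
  have ht2 : 0 < 2 * L ^ 2 / μ ^ 2 := by positivity
  have ht3 : 0 < (1 + 16 / lam) * (192 * L ^ 2 / (μ ^ 2 * lam)) := by positivity
  -- The summand 32/λ is what `le_div_sq_of_recursion` asks for, and the last one makes the step
  -- small enough for `integral_dispersion_halfStep_le`. The summand 2 also gives k₁ ≥ 1, hence (j +
  -- k₁)² ≥ j + k₁. The average model later uses 2 and 2L²/μ², the latter for α L² ≤ μ.
  unfold shiftThreshold at hk₁
  have hm : ∀ j : ℕ, k₁ ≤ (j : ℝ) + k₁ := fun j => by simp
  have hm0 : ∀ j : ℕ, 0 < (j : ℝ) + k₁ := fun j => by linarith [hm j]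
  have hhalf : ∀ j : ℕ,
      ∫ ω, dispersion (halfStep f (S ω) (2 / (μ * (j + k₁))) (idx j ω) (x j ω)) ∂P
        ≤ (1 + lam / 8) * ∫ ω, dispersion (x j ω) ∂P
          + dispersionConst μ lam * (σ ^ 2 + δ ^ 2) / (j + k₁) ^ 2 := fun j => by
    have hmj := hm0 j
    refine (R.integral_dispersion_halfStep_le (k := j) ?_).trans_eq ?_
    · have h1 : (1 + 16 / lam) * (192 * L ^ 2 / (μ ^ 2 * lam)) ≤ ((j : ℝ) + k₁) ^ 2 := by
        nlinarith [hm j]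
      have e : (1 + 16 / lam) * (3 * (2 / (μ * (j + k₁))) ^ 2 * L ^ 2)
          = (1 + 16 / lam) * (192 * L ^ 2 / (μ ^ 2 * lam)) * (lam / 16 / ((j : ℝ) + k₁) ^ 2) := by
        field_simp; ring
      rw [e]
      calc _ ≤ ((j : ℝ) + k₁) ^ 2 * (lam / 16 / ((j : ℝ) + k₁) ^ 2) := by gcongr
        _ = lam / 16 := by field_simp
    · unfold dispersionConst; field_simp; ring
  have hV : 0 ≤ σ ^ 2 + δ ^ 2 := by positivity
  have hD : 0 ≤ dispersionConst μ lam * (σ ^ 2 + δ ^ 2) := by unfold dispersionConst; positivity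
  have hx : ∀ j : ℕ, ∫ ω, dispersion (x j ω) ∂P
      ≤ 16 * (dispersionConst μ lam * (σ ^ 2 + δ ^ 2)) / lam / (j + k₁) ^ 2 := by
    refine le_div_sq_of_recursion hlam hlam1 hD (by linarith) ?_
      (fun j => integral_nonneg fun ω => dispersion_nonneg _) fun j => ?_
    · have : ∀ ω, dispersion (x 0 ω) = 0 := fun ω => by
        have e : x 0 ω = fun _ => x₀ := funext (R.x_zero ω)
        simp [dispersion, e, meanModel_const R.N_pos]
      simp [this]
    · refine (R.integral_dispersion_succ_le j).trans ?_
      exact mul_le_mul_of_nonneg_left (hhalf j) (by linarith)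
  have e1 : 16 * (dispersionConst μ lam * (σ ^ 2 + δ ^ 2)) / lam / ((k : ℝ) + k₁) ^ 2
      = 16 * dispersionConst μ lam / lam * (σ ^ 2 + δ ^ 2) / (k + k₁) ^ 2 := by ring
  have h1 := hx k
  rw [e1] at h1
  refine ⟨h1, (hhalf k).trans ?_⟩
  have h0 : 0 ≤ ∫ ω, dispersion (x k ω) ∂P := integral_nonneg fun ω => dispersion_nonneg _
  calc _ ≤ 2 * ∫ ω, dispersion (x k ω) ∂P
        + dispersionConst μ lam * (σ ^ 2 + δ ^ 2) / (k + k₁) ^ 2 := by gcongr; linarith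
    _ ≤ 2 * (16 * dispersionConst μ lam / lam * (σ ^ 2 + δ ^ 2) / (k + k₁) ^ 2)
        + dispersionConst μ lam * (σ ^ 2 + δ ^ 2) / (k + k₁) ^ 2 := by gcongr
    _ = _ := by ring

/-- The convergence rate of the average model to the minimizer of the empirical loss. -/
theorem integral_meanModel_rate
    (R : IsDsgdRun f G A W μ L lam ρ (fun k => 2 / (μ * (k + k₁))) x₀ P 𝓕 D S idx byz σ δ xs x)
    (hk₁ : shiftThreshold μ L lam ≤ k₁) (k : ℕ) :
    ∫ ω, ‖meanModel (x k ω) - xs ω‖ ^ 2 ∂P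
      ≤ (k₁ * ∫ ω, ‖meanModel (x 0 ω) - xs ω‖ ^ 2 ∂P + rateConst μ L lam * (σ ^ 2 + δ ^ 2))
          / (k + k₁)
        + rateConst μ L lam * ((4 * ρ ^ 2 * N + chiSq W) * (σ ^ 2 + δ ^ 2)) := by
  have hμ := R.mu_pos
  have hL := R.L_pos
  have hlam := R.lam_pos
  have hrate := R.integral_dispersion_rate hk₁
  have ht1 : 0 < 32 / lam := by positivity
  have ht2 : 0 < 2 * L ^ 2 / μ ^ 2 := by positivity
  have ht3 : 0 < (1 + 16 / lam) * (192 * L ^ 2 / (μ ^ 2 * lam)) := by positivity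
  unfold shiftThreshold at hk₁
  have hDc : 0 < dispersionConst μ lam := by unfold dispersionConst; positivity
  have hΨ : 0 ≤ 4 * ρ ^ 2 * N + chiSq W := add_nonneg (by positivity) (chiSq_nonneg W)
  have hrc : rateConst μ L lam
      = 2 * (72 * L ^ 2 * (16 * dispersionConst μ lam / lam) / μ ^ 2 + 8 / μ ^ 2)
        + 18 * (2 * (16 * dispersionConst μ lam / lam) + dispersionConst μ lam) := rfl
  have hc1 : 0 < 16 * dispersionConst μ lam / lam := by positivity
  generalize 16 * dispersionConst μ lam / lam = c₁ at *
  have hc2 : 0 < 2 * c₁ + dispersionConst μ lam := by positivity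
  generalize 2 * c₁ + dispersionConst μ lam = c₂ at *
  generalize hΨe : 4 * ρ ^ 2 * N + chiSq W = Ψ at *
  have hV : 0 ≤ σ ^ 2 + δ ^ 2 := by positivity
  have hσV : σ ^ 2 ≤ σ ^ 2 + δ ^ 2 := by nlinarith [sq_nonneg δ]
  have hR0 : ∀ j : ℕ, 0 ≤ ∫ ω, ‖meanModel (x j ω) - xs ω‖ ^ 2 ∂P := fun j =>
    integral_nonneg fun ω => by positivity
  have hrec : ∀ j : ℕ, ∫ ω, ‖meanModel (x (j + 1) ω) - xs ω‖ ^ 2 ∂P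
      ≤ (1 - 3 / 2 / (j + k₁)) * ∫ ω, ‖meanModel (x j ω) - xs ω‖ ^ 2 ∂P
        + (72 * L ^ 2 * c₁ / μ ^ 2 + 8 / μ ^ 2) * (σ ^ 2 + δ ^ 2) / (j + k₁) ^ 2
        + 18 * c₂ * (Ψ * (σ ^ 2 + δ ^ 2)) / (j + k₁) := fun j => by
    have hmk : k₁ ≤ (j : ℝ) + k₁ := by simp
    obtain ⟨h1, h2⟩ := hrate j
    have hr := hR0 j
    have hαL : 2 / (μ * (j + k₁)) * L ^ 2 ≤ μ := by
      have hm0 : 0 < (j : ℝ) + k₁ := by linarith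
      have h3 : 2 * L ^ 2 / μ ^ 2 ≤ j + k₁ := by linarith
      rw [div_le_iff₀ (by positivity)] at h3
      rw [div_mul_eq_mul_div, div_le_iff₀ (by positivity)]
      linarith
    have hm0 : 0 < (j : ℝ) + k₁ := by linarith
    -- With αμ = 2/m and τ = 1/(8m), the two Young factors reduce the contraction only from 2/m to
    -- 3/(2m), while 1 + 1/τ ≤ 9m. Against a dispersion of order 1/m² this turns the aggregation
    -- term into order 1/m, the source of the floor; the Lipschitz term has an additional α² and
    -- becomes of order 1/m³.
    have h := R.integral_meanModel_succ_le (k := j) (τ := 1 / (8 * (j + k₁))) (by positivity) hαL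
      (by positivity)
    rw [hΨe] at h
    have hm2 : 2 ≤ (j : ℝ) + k₁ := by linarith
    have hd : 0 ≤ ∫ ω, dispersion (x j ω) ∂P := integral_nonneg fun ω => dispersion_nonneg _
    have hd' : 0 ≤ ∫ ω, dispersion (halfStep f (S ω) (2 / (μ * (j + k₁))) (idx j ω) (x j ω)) ∂P :=
      integral_nonneg fun ω => dispersion_nonneg _
    generalize ((j : ℝ) + k₁) = m at *
    have hτ : 1 + 1 / (8 * m) ≤ 2 := by
      have : 1 / (8 * m) ≤ 1 := by rw [div_le_one (by positivity)]; linarith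
      linarith
    have hτ' : 1 + 1 / (1 / (8 * m)) ≤ 9 * m := by rw [one_div_one_div]; linarith
    have hτ0 : 0 ≤ 1 + 1 / (1 / (8 * m)) := by positivity
    have hτ1 : 0 ≤ 1 + 1 / (8 * m) := by positivity
    have hcoef : (1 + 1 / (8 * m)) * ((1 + 1 / (8 * m)) * (1 - 2 / (μ * m) * μ))
        ≤ 1 - 3 / 2 / m := by
      have e : 1 - 3 / 2 / m - (1 + 1 / (8 * m)) * ((1 + 1 / (8 * m)) * (1 - 2 / (μ * m) * μ))
          = (16 * m ^ 2 + 31 * m + 2) / (64 * m ^ 3) := by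
        field_simp; ring
      have : 0 ≤ (16 * m ^ 2 + 31 * m + 2) / (64 * m ^ 3) := by positivity
      linarith
    refine h.trans ?_
    rw [mul_add, mul_add, ← mul_assoc]
    have g1 : (1 + 1 / (8 * m)) * ((1 + 1 / (8 * m)) * (1 - 2 / (μ * m) * μ))
        * ∫ ω, ‖meanModel (x j ω) - xs ω‖ ^ 2 ∂P
        ≤ (1 - 3 / 2 / m) * ∫ ω, ‖meanModel (x j ω) - xs ω‖ ^ 2 ∂P := by gcongr
    have g2 : (1 + 1 / (8 * m)) * ((1 + 1 / (1 / (8 * m))) * ((2 / (μ * m)) ^ 2 * L ^ 2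
        * ∫ ω, dispersion (x j ω) ∂P)) ≤ 72 * L ^ 2 * c₁ / μ ^ 2 * (σ ^ 2 + δ ^ 2) / m ^ 2 := by
      calc _ ≤ 2 * (9 * m * ((2 / (μ * m)) ^ 2 * L ^ 2 * (c₁ * (σ ^ 2 + δ ^ 2) / m ^ 2))) := by
            gcongr
        _ = 72 * L ^ 2 * c₁ / μ ^ 2 * (σ ^ 2 + δ ^ 2) / m ^ 2 / m := by field_simp; ring
        _ ≤ _ := div_le_self (by positivity) (by linarith)
    have g3 : (1 + 1 / (8 * m)) * ((2 / (μ * m)) ^ 2 * σ ^ 2)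
        ≤ 8 / μ ^ 2 * (σ ^ 2 + δ ^ 2) / m ^ 2 := by
      calc _ ≤ 2 * ((2 / (μ * m)) ^ 2 * (σ ^ 2 + δ ^ 2)) := by gcongr
        _ = _ := by field_simp; ring
    have g4 : (1 + 1 / (1 / (8 * m))) * (2 * Ψ
        * ∫ ω, dispersion (halfStep f (S ω) (2 / (μ * m)) (idx j ω) (x j ω)) ∂P)
        ≤ 18 * c₂ * (Ψ * (σ ^ 2 + δ ^ 2)) / m := by
      calc _ ≤ 9 * m * (2 * Ψ * (c₂ * (σ ^ 2 + δ ^ 2) / m ^ 2)) := by gcongr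
        _ = _ := by field_simp; ring
    have e : (72 * L ^ 2 * c₁ / μ ^ 2 + 8 / μ ^ 2) * (σ ^ 2 + δ ^ 2) / m ^ 2
        = 72 * L ^ 2 * c₁ / μ ^ 2 * (σ ^ 2 + δ ^ 2) / m ^ 2
          + 8 / μ ^ 2 * (σ ^ 2 + δ ^ 2) / m ^ 2 := by ring
    rw [e]
    linarith [g1, g2, g3, g4]
  have h := le_div_add_of_recursion (r := fun j => ∫ ω, ‖meanModel (x j ω) - xs ω‖ ^ 2 ∂P)
    (a := (72 * L ^ 2 * c₁ / μ ^ 2 + 8 / μ ^ 2) * (σ ^ 2 + δ ^ 2))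
    (b := 18 * c₂ * (Ψ * (σ ^ 2 + δ ^ 2))) (by positivity) (by positivity) (by linarith) (hR0 0)
    hrec k
  refine h.trans ?_
  have hm0 : 0 < (k : ℝ) + k₁ := by
    have : (0 : ℝ) ≤ k := by positivity
    linarith
  have hc3 : 18 * c₂ ≤ rateConst μ L lam := by
    rw [hrc]; exact le_add_of_nonneg_left (by positivity)
  have hc4 : 2 * (72 * L ^ 2 * c₁ / μ ^ 2 + 8 / μ ^ 2) ≤ rateConst μ L lam := by
    rw [hrc]; exact le_add_of_nonneg_right (by positivity)
  rw [← mul_assoc 2]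
  gcongr

end IsDsgdRun

/-! ### The empirical gradient at the population minimizer. -/

section IndependentSums

variable {d : ℕ} {Ω : Type*} {mΩ : MeasurableSpace Ω} {P : Measure Ω} [IsProbabilityMeasure P]

/-- The second moment of a centred sum of independent random vectors. -/
lemma integral_norm_sum_sq_le {ι : Type*} [Fintype ι] {V : ι → Ω → Model d}
    (hV : ∀ i, MemLp (V i) 2 P) (hind : Pairwise fun i j => IndepFun (V i) (V j) P)
    (h0 : ∫ ω, ∑ i, V i ω ∂P = 0) :
    ∫ ω, ‖∑ i, V i ω‖ ^ 2 ∂P ≤ ∑ i, ∫ ω, ‖V i ω‖ ^ 2 ∂P := by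
  have hc : ∀ (i : ι) (j : Fin d), MemLp (fun ω => V i ω j) 2 P := fun i j =>
    (hV i).continuousLinearMap_comp (EuclideanSpace.proj j : Model d →L[ℝ] ℝ)
  have hs : MemLp (fun ω => ∑ i, V i ω) 2 P := memLp_finsetSum _ fun i _ => hV i
  have hsc : ∀ j : Fin d, MemLp (fun ω => ∑ i, V i ω j) 2 P := fun j =>
    memLp_finsetSum _ fun i _ => hc i j
  have hj : ∀ j : Fin d, ∫ ω, (∑ i, V i ω j) ^ 2 ∂P ≤ ∑ i, ∫ ω, (V i ω j) ^ 2 ∂P := fun j => by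
    have hz : ∫ ω, ∑ i, V i ω j ∂P = 0 := by
      have := (EuclideanSpace.proj j : Model d →L[ℝ] ℝ).integral_comp_comm
        (hs.integrable one_le_two)
      rw [h0, map_zero] at this
      simpa using this
    have hm : Measurable fun v : Model d => v j :=
      (EuclideanSpace.proj j : Model d →L[ℝ] ℝ).continuous.measurable
    -- Only the total is centred: the agents' distributions differ, so single terms may have nonzero
    -- mean. The second moment of the sum equals its variance, variances add, and each is at most a
    -- second moment.
    have hvar := IndepFun.variance_sum (μ := P) (X := fun i ω => V i ω j) (s := Finset.univ)
      (fun i _ => hc i j) fun i _ i' _ hii => (hind hii).comp hm hm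
    have e : (∑ i, fun ω => V i ω j) = fun ω => ∑ i, V i ω j := by
      funext ω; simp
    rw [e, variance_of_integral_eq_zero (hsc j).1.aemeasurable hz] at hvar
    rw [hvar]
    exact Finset.sum_le_sum fun i _ => variance_le_expectation_sq (hc i j).1
  simp only [EuclideanSpace.real_norm_sq_eq, WithLp.ofLp_sum, Finset.sum_apply]
  rw [integral_finsetSum _ fun j _ => (hsc j).integrable_sq]
  refine (Finset.sum_le_sum fun j _ => hj j).trans_eq ?_
  rw [Finset.sum_comm]
  refine Finset.sum_congr rfl fun i _ => ?_
  rw [integral_finsetSum _ fun j _ => (hc i j).integrable_sq]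

end IndependentSums

lemma empiricalGrad_eq_sum {d N Z : ℕ} {Ξ : Type*} (f : Model d → Ξ → ℝ) (S : Fin N → Fin Z → Ξ)
    (x : Model d) : empiricalGrad f S x
      = (1 / ((N : ℝ) * Z)) • ∑ p : Fin N × Fin Z, lossGrad f (S p.1 p.2) x := by
  rw [Fintype.sum_prod_type]
  simp only [empiricalGrad, localGrad, meanModel, ← Finset.smul_sum, smul_smul]
  congr 1
  ring

namespace IsDsgdRun

variable {N B Z d : ℕ} {Ξ Ω : Type*} [MeasurableSpace Ξ] {mΩ : MeasurableSpace Ω}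
  {f : Model d → Ξ → ℝ} {G : SimpleGraph (Fin N ⊕ Fin B)}
  {A : (n : Fin N) → AggregationRule G d n} {W : Matrix (Fin N) (Fin N) ℝ}
  {μ L lam ρ : ℝ} {α : ℕ → ℝ} {x₀ : Model d} {P : Measure Ω} {𝓕 : Filtration ℕ mΩ}
  {D : Fin N → Measure Ξ} {S : Ω → Fin N → Fin Z → Ξ} {idx : ℕ → Ω → Fin N → Fin Z}
  {byz : ℕ → Fin B → Fin N → Ω → Model d} {σ δ : ℝ} {xs : Ω → Model d}
  {x : ℕ → Ω → Fin N → Model d}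

lemma measurable_data (R : IsDsgdRun f G A W μ L lam ρ α x₀ P 𝓕 D S idx byz σ δ xs x) (n : Fin N)
    (z : Fin Z) : Measurable fun ω => S ω n z :=
  (R.setup.data_meas n z).mono (𝓕.le 0) le_rfl

lemma memLp_const_sub (R : IsDsgdRun f G A W μ L lam ρ α x₀ P 𝓕 D S idx byz σ δ xs x)
    (y : Model d) : MemLp (fun ω => y - xs ω) 2 P := by
  have := R.prob
  refine ((memLp_const (y - x₀)).add R.memLp_init).ae_eq (Filter.Eventually.of_forall fun ω => ?_)
  simp

lemma memLp_lossGrad_const (R : IsDsgdRun f G A W μ L lam ρ α x₀ P 𝓕 D S idx byz σ δ xs x)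
    (y : Model d) (n : Fin N) (z : Fin Z) : MemLp (fun ω => lossGrad f (S ω n z) y) 2 P :=
  R.memLp_lossGrad (R.measurable_data n z) (fun _ => ⟨z, rfl⟩) measurable_const (R.memLp_const_sub y)

lemma memLp_empiricalGrad_const
    (R : IsDsgdRun f G A W μ L lam ρ α x₀ P 𝓕 D S idx byz σ δ xs x) (y : Model d) :
    MemLp (fun ω => empiricalGrad f (S ω) y) 2 P :=
  memLp_meanModel (u := fun ω n => localGrad f (S ω n) y) fun n =>
    R.memLp_localGrad n measurable_const (R.memLp_const_sub y)

lemma integrable_inner_empiricalGrad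
    (R : IsDsgdRun f G A W μ L lam ρ α x₀ P 𝓕 D S idx byz σ δ xs x) (y v : Model d) :
    Integrable (fun ω => inner ℝ (empiricalGrad f (S ω) y) v) P := by
  have := R.prob
  exact (R.memLp_empiricalGrad_const y).integrable_inner_two (memLp_const v)

lemma integral_inner_empiricalGrad
    (R : IsDsgdRun f G A W μ L lam ρ α x₀ P 𝓕 D S idx byz σ δ xs x) (y v : Model d) :
    ∫ ω, inner ℝ (empiricalGrad f (S ω) y) v ∂P
      = inner ℝ (∫ ω, empiricalGrad f (S ω) y ∂P) v := by
  have := R.prob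
  simp only [real_inner_comm v]
  exact integral_inner ((R.memLp_empiricalGrad_const y).integrable one_le_two) v

/-- The expected gradient has a zero: the minimizer of the population loss. -/
lemma exists_integral_empiricalGrad_eq_zero
    (R : IsDsgdRun f G A W μ L lam ρ α x₀ P 𝓕 D S idx byz σ δ xs x) :
    ∃ y : Model d, ∫ ω, empiricalGrad f (S ω) y ∂P = 0 := by
  have := R.prob
  have hreg := fun ω => R.convex.regularMap_empiricalGrad R.smooth R.N_pos R.Z_pos (S ω)
  have hi := fun y => (R.memLp_empiricalGrad_const y).integrable one_le_two
  -- Strong monotonicity and the Lipschitz bound survive expectation, so the fixed-point argument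
  -- applies on a one-point space, without differentiating the population loss.
  have h : RegularMap μ L fun y => ∫ ω, empiricalGrad f (S ω) y ∂P :=
    { mono := fun y z => by
        rw [inner_sub_left, ← R.integral_inner_empiricalGrad, ← R.integral_inner_empiricalGrad,
          ← integral_sub (R.integrable_inner_empiricalGrad _ _)
            (R.integrable_inner_empiricalGrad _ _)]
        calc _ = ∫ _ω, μ * ‖y - z‖ ^ 2 ∂P := by simp
          _ ≤ _ := integral_mono (integrable_const _) ((R.integrable_inner_empiricalGrad _ _).sub
            (R.integrable_inner_empiricalGrad _ _)) fun ω =>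
              ((hreg ω).mono y z).trans_eq (inner_sub_left _ _ _)
      lip := fun y z => by
        rw [← integral_sub (hi y) (hi z)]
        have := norm_integral_le_of_norm_le_const (μ := P)
          (Filter.Eventually.of_forall fun ω => (hreg ω).lip y z)
        simpa using this }
  obtain ⟨y, -, hy⟩ := exists_measurable_zero (Ω := Unit) R.mu_pos (fun _ => h)
    (fun _ => measurable_const)
  exact ⟨y (), hy ()⟩

/-- The empirical gradient at the population minimizer, by independence of the samples. -/
lemma integral_empiricalGrad_sq_le
    (R : IsDsgdRun f G A W μ L lam ρ α x₀ P 𝓕 D S idx byz σ δ xs x) {y : Model d}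
    (hy : ∫ ω, empiricalGrad f (S ω) y ∂P = 0) :
    ((N : ℝ) * Z - 1) * ∫ ω, ‖empiricalGrad f (S ω) y‖ ^ 2 ∂P ≤ σ ^ 2 + δ ^ 2 := by
  have := R.prob
  have hN : (0 : ℝ) < N := by exact_mod_cast R.N_pos
  have hZ : (0 : ℝ) < Z := by exact_mod_cast R.Z_pos
  set V : Fin N × Fin Z → Ω → Model d := fun p ω => lossGrad f (S ω p.1 p.2) y
  have hV : ∀ p, MemLp (V p) 2 P := fun p => R.memLp_lossGrad_const y p.1 p.2
  have hind : Pairwise fun p q => IndepFun (V p) (V q) P := fun p q hpq =>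
    (R.setup.data_indep.indepFun hpq).comp (R.convex.measurable_lossGrad R.loss_meas y)
      (R.convex.measurable_lossGrad R.loss_meas y)
  have e : ∀ ω, empiricalGrad f (S ω) y = (1 / ((N : ℝ) * Z)) • ∑ p, V p ω := fun ω =>
    empiricalGrad_eq_sum f (S ω) y
  have h0 : ∫ ω, ∑ p, V p ω ∂P = 0 := by
    simp only [e] at hy
    rw [integral_smul, smul_eq_zero] at hy
    exact hy.resolve_left (by positivity)
  have h1 := integral_norm_sum_sq_le hV hind h0
  have h2 : ∫ ω, ‖empiricalGrad f (S ω) y‖ ^ 2 ∂P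
      = (1 / ((N : ℝ) * Z)) ^ 2 * ∫ ω, ‖∑ p, V p ω‖ ^ 2 ∂P := by
    rw [← integral_const_mul]
    simp only [e, norm_smul, mul_pow, Real.norm_eq_abs, sq_abs]
  have hg2 := (R.memLp_empiricalGrad_const y).integrable_norm_sq
  -- The assumptions bound deviations from the empirical gradient and not from the population one.
  -- The bias-variance identity therefore leaves ‖∇F_S(y)‖² on the right, and the final inequality
  -- is solved for its expectation `Γ`.
  have h3 : (1 / ((N : ℝ) * Z)) * ∑ p, ∫ ω, ‖V p ω‖ ^ 2 ∂P
      ≤ σ ^ 2 + δ ^ 2 + ∫ ω, ‖empiricalGrad f (S ω) y‖ ^ 2 ∂P := by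
    rw [← integral_finsetSum _ fun p _ => (hV p).integrable_norm_sq, ← integral_const_mul]
    calc _ ≤ ∫ ω, (σ ^ 2 + δ ^ 2 + ‖empiricalGrad f (S ω) y‖ ^ 2) ∂P := by
          refine integral_mono_ae ((integrable_finsetSum _ fun p _ =>
            (hV p).integrable_norm_sq).const_mul _) ((integrable_const _).add hg2) ?_
          filter_upwards [R.noise, R.het] with ω hσ hδ
          have hb := mean_norm_lossGrad_sub_le R.convex R.Z_pos R.N_pos hσ hδ y
          have hvar : ∀ n, (1 / (Z : ℝ)) * ∑ z, ‖lossGrad f (S ω n z) y‖ ^ 2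
              = (1 / (Z : ℝ)) * ∑ z, ‖lossGrad f (S ω n z) y - empiricalGrad f (S ω) y‖ ^ 2
                + (‖localGrad f (S ω n) y‖ ^ 2
                  - ‖localGrad f (S ω n) y - empiricalGrad f (S ω) y‖ ^ 2) := fun n => by
            have a1 := mean_norm_sub_sq R.Z_pos (fun z => lossGrad f (S ω n z) y) 0
            have a2 := mean_norm_sub_sq R.Z_pos (fun z => lossGrad f (S ω n z) y)
              (empiricalGrad f (S ω) y)
            simp only [sub_zero] at a1
            rw [a1, a2]
            simp only [localGrad]
            ring
          have b1 := mean_norm_sub_sq R.N_pos (fun n => localGrad f (S ω n) y) 0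
          have b2 := mean_norm_sub_sq R.N_pos (fun n => localGrad f (S ω n) y)
            (empiricalGrad f (S ω) y)
          have e1 : (meanModel fun n => localGrad f (S ω n) y) = empiricalGrad f (S ω) y := rfl
          simp only [sub_zero, e1, sub_self, norm_zero] at b1 b2
          have e2 : (1 / ((N : ℝ) * Z)) * ∑ p, ‖V p ω‖ ^ 2
              = (1 / (N : ℝ)) * ∑ n, (1 / (Z : ℝ)) * ∑ z, ‖lossGrad f (S ω n z) y‖ ^ 2 := by
            rw [Fintype.sum_prod_type, ← Finset.mul_sum, ← mul_assoc, one_div_mul_one_div]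
          rw [e2]
          simp only [hvar]
          rw [Finset.sum_add_distrib, Finset.sum_sub_distrib, mul_add, mul_sub, b1, b2]
          linarith
      _ = _ := by rw [integral_add (integrable_const _) hg2]; simp
  set Γ := ∫ ω, ‖empiricalGrad f (S ω) y‖ ^ 2 ∂P
  have h4 : N * Z * Γ ≤ σ ^ 2 + δ ^ 2 + Γ := by
    refine le_trans ?_ h3
    rw [h2]
    calc N * Z * ((1 / ((N : ℝ) * Z)) ^ 2 * ∫ ω, ‖∑ p, V p ω‖ ^ 2 ∂P)
        = (1 / ((N : ℝ) * Z)) * ∫ ω, ‖∑ p, V p ω‖ ^ 2 ∂P := by field_simp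
      _ ≤ _ := by gcongr
  linarith

/-- The empirical gradient at the population minimizer, by the distance of the minimizers. -/
lemma integral_empiricalGrad_sq_le_init
    (R : IsDsgdRun f G A W μ L lam ρ α x₀ P 𝓕 D S idx byz σ δ xs x) {y : Model d}
    (hy : ∫ ω, empiricalGrad f (S ω) y ∂P = 0) :
    ∫ ω, ‖empiricalGrad f (S ω) y‖ ^ 2 ∂P
      ≤ 2 * L ^ 2 * (L ^ 2 / μ ^ 2 + 1) * ∫ ω, ‖x₀ - xs ω‖ ^ 2 ∂P := by
  have := R.prob
  have hμ := R.mu_pos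
  have hL := R.L_pos
  have hreg := fun ω => R.convex.regularMap_empiricalGrad R.smooth R.N_pos R.Z_pos (S ω)
  have hlip : ∀ (u : Model d) ω, ‖empiricalGrad f (S ω) u‖ ^ 2 ≤ L ^ 2 * ‖u - xs ω‖ ^ 2 :=
    fun u ω => by
      have := (hreg ω).lip u (xs ω)
      rw [R.xs_zero, sub_zero] at this
      rw [← mul_pow]; gcongr
  have hi := R.memLp_init.integrable_norm_sq
  set R₀ := ∫ ω, ‖x₀ - xs ω‖ ^ 2 ∂P
  have hcm : ∀ c : ℝ, ∫ ω, c * ‖x₀ - xs ω‖ ^ 2 ∂P = c * R₀ := fun c => integral_const_mul c _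
  -- Strong monotonicity of the empirical gradient between x₀ and y is integrated: the part at `y`
  -- has mean zero, and the part at x₀ is at most L‖x₀ - xs‖.
  have hdist : μ ^ 2 * ‖x₀ - y‖ ^ 2 ≤ L ^ 2 * R₀ := by
    have h1 : ∀ ω, inner ℝ (empiricalGrad f (S ω) y) (x₀ - y) + μ / 2 * ‖x₀ - y‖ ^ 2
        ≤ L ^ 2 / (2 * μ) * ‖x₀ - xs ω‖ ^ 2 := fun ω => by
      have a1 := (hreg ω).mono x₀ y
      rw [inner_sub_left] at a1
      have a2 := real_inner_le_norm (empiricalGrad f (S ω) x₀) (x₀ - y)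
      have a3 := hlip x₀ ω
      have a4 : ‖empiricalGrad f (S ω) x₀‖ * ‖x₀ - y‖
          ≤ ‖empiricalGrad f (S ω) x₀‖ ^ 2 / (2 * μ) + μ / 2 * ‖x₀ - y‖ ^ 2 := by
        have e : ‖empiricalGrad f (S ω) x₀‖ ^ 2 / (2 * μ) + μ / 2 * ‖x₀ - y‖ ^ 2
            - ‖empiricalGrad f (S ω) x₀‖ * ‖x₀ - y‖
            = (‖empiricalGrad f (S ω) x₀‖ - μ * ‖x₀ - y‖) ^ 2 / (2 * μ) := by
          field_simp; ring
        have : 0 ≤ (‖empiricalGrad f (S ω) x₀‖ - μ * ‖x₀ - y‖) ^ 2 / (2 * μ) := by positivity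
        linarith
      have a5 : ‖empiricalGrad f (S ω) x₀‖ ^ 2 / (2 * μ)
          ≤ L ^ 2 / (2 * μ) * ‖x₀ - xs ω‖ ^ 2 := by
        rw [div_mul_eq_mul_div]; gcongr
      linarith
    have h2 := integral_mono ((R.integrable_inner_empiricalGrad y (x₀ - y)).add
      (integrable_const _)) (hi.const_mul _) h1
    rw [integral_add' (R.integrable_inner_empiricalGrad y (x₀ - y)) (integrable_const _),
      R.integral_inner_empiricalGrad, hy, inner_zero_left, hcm] at h2
    simp only [integral_const, probReal_univ, one_smul, zero_add] at h2
    have h3 := mul_le_mul_of_nonneg_left h2 (by positivity : 0 ≤ 2 * μ)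
    have e : 2 * μ * (L ^ 2 / (2 * μ) * R₀) = L ^ 2 * R₀ := by field_simp
    linarith
  calc _ ≤ ∫ ω, (2 * L ^ 2 * ‖x₀ - y‖ ^ 2 + 2 * L ^ 2 * ‖x₀ - xs ω‖ ^ 2) ∂P := by
        refine integral_mono (R.memLp_empiricalGrad_const y).integrable_norm_sq
          ((integrable_const _).add (hi.const_mul _)) fun ω => (hlip y ω).trans ?_
        have h3 := norm_add_sq_le_two (y - x₀) (x₀ - xs ω)
        rw [sub_add_sub_cancel, norm_sub_rev y x₀] at h3
        nlinarith [sq_nonneg L]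
    _ = 2 * L ^ 2 * ‖x₀ - y‖ ^ 2 + 2 * L ^ 2 * R₀ := by
        rw [integral_add (integrable_const _) (hi.const_mul _), hcm]; simp
    _ ≤ 2 * L ^ 2 * (L ^ 2 / μ ^ 2 * R₀) + 2 * L ^ 2 * R₀ := by
        gcongr
        rw [div_mul_eq_mul_div, le_div_iff₀ (by positivity)]
        linarith
    _ = _ := by ring

end IsDsgdRun

/-! ### From distances to the generalization error. -/

namespace IsDsgdRun

variable {N B Z d : ℕ} {Ξ Ω : Type*} [MeasurableSpace Ξ] {mΩ : MeasurableSpace Ω}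
  {f : Model d → Ξ → ℝ} {G : SimpleGraph (Fin N ⊕ Fin B)}
  {A : (n : Fin N) → AggregationRule G d n} {W : Matrix (Fin N) (Fin N) ℝ}
  {μ L lam ρ : ℝ} {α : ℕ → ℝ} {x₀ : Model d} {P : Measure Ω} {𝓕 : Filtration ℕ mΩ}
  {D : Fin N → Measure Ξ} {S : Ω → Fin N → Fin Z → Ξ} {idx : ℕ → Ω → Fin N → Fin Z}
  {byz : ℕ → Fin B → Fin N → Ω → Model d} {σ δ : ℝ} {xs : Ω → Model d}
  {x : ℕ → Ω → Fin N → Model d}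

lemma isProbabilityMeasure_law (R : IsDsgdRun f G A W μ L lam ρ α x₀ P 𝓕 D S idx byz σ δ xs x)
    (n : Fin N) : IsProbabilityMeasure (D n) := by
  have := R.prob
  rw [← R.setup.data_law n ⟨0, R.Z_pos⟩]
  exact Measure.isProbabilityMeasure_map (R.measurable_data n _).aemeasurable

lemma integrable_loss (R : IsDsgdRun f G A W μ L lam ρ α x₀ P 𝓕 D S idx byz σ δ xs x)
    (hint : ∀ x n, Integrable (f x) (D n)) (u : Model d) (n : Fin N) (z : Fin Z) :
    Integrable (fun ω => f u (S ω n z)) P := by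
  have h := hint u n
  rw [← R.setup.data_law n z] at h
  exact h.comp_measurable (R.measurable_data n z)

lemma integrable_empiricalLoss (R : IsDsgdRun f G A W μ L lam ρ α x₀ P 𝓕 D S idx byz σ δ xs x)
    (hint : ∀ x n, Integrable (f x) (D n)) (u : Model d) :
    Integrable (fun ω => empiricalLoss f (S ω) u) P :=
  (integrable_finsetSum _ fun n _ => (integrable_finsetSum _ fun z _ =>
    R.integrable_loss hint u n z).const_mul _).const_mul _

/-- The population loss is the expected empirical loss at a fixed model. -/
lemma populationLoss_eq (R : IsDsgdRun f G A W μ L lam ρ α x₀ P 𝓕 D S idx byz σ δ xs x)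
    (hint : ∀ x n, Integrable (f x) (D n)) (u : Model d) :
    populationLoss f D u = ∫ ω, empiricalLoss f (S ω) u ∂P := by
  have hZ : (Z : ℝ) ≠ 0 := by have := R.Z_pos; positivity
  simp only [populationLoss, empiricalLoss, localLoss]
  rw [integral_const_mul, integral_finsetSum _ fun n _ => (integrable_finsetSum _ fun z _ =>
    R.integrable_loss hint u n z).const_mul _]
  congr 1
  refine Finset.sum_congr rfl fun n _ => ?_
  rw [integral_const_mul, integral_finsetSum _ fun z _ => R.integrable_loss hint u n z]
  have : ∀ z, ∫ ω, f u (S ω n z) ∂P = ∫ ξ, f u ξ ∂(D n) := fun z => by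
    rw [← R.setup.data_law n z, integral_map (R.measurable_data n z).aemeasurable
      (R.loss_meas u).aestronglyMeasurable]
  simp [this, hZ]

lemma measurable_populationLoss
    (R : IsDsgdRun f G A W μ L lam ρ α x₀ P 𝓕 D S idx byz σ δ xs x) :
    Measurable (populationLoss f D) := by
  refine (Finset.measurable_sum _ fun n _ => ?_).const_mul _
  have := R.isProbabilityMeasure_law n
  exact (R.convex.measurable_uncurry_loss R.loss_meas).stronglyMeasurable.integral_prod_right'.measurable

lemma measurable_empiricalLoss_comp
    (R : IsDsgdRun f G A W μ L lam ρ α x₀ P 𝓕 D S idx byz σ δ xs x) {u : Ω → Model d}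
    (hu : Measurable u) : Measurable fun ω => empiricalLoss f (S ω) (u ω) :=
  (Finset.measurable_sum _ fun n _ => (Finset.measurable_sum _ fun z _ =>
    (R.convex.measurable_uncurry_loss R.loss_meas).comp
      (hu.prodMk (R.measurable_data n z))).const_mul _).const_mul _

/-- The generalization error of a random model is controlled by its distance to the empirical
minimizer and by the empirical gradient at the population minimizer. -/
lemma generalizationError_le (R : IsDsgdRun f G A W μ L lam ρ α x₀ P 𝓕 D S idx byz σ δ xs x)
    (hint : ∀ x n, Integrable (f x) (D n)) {y : Model d}
    (hy : ∫ ω, empiricalGrad f (S ω) y ∂P = 0) {u : Ω → Model d} (hu : Measurable u)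
    (hu2 : MemLp (fun ω => u ω - xs ω) 2 P) :
    Integrable (fun ω => populationLoss f D (u ω) - empiricalLoss f (S ω) (u ω)) P ∧
    ∫ ω, (populationLoss f D (u ω) - empiricalLoss f (S ω) (u ω)) ∂P
      ≤ (2 * L + 1) * (1 + 1 / μ ^ 2) * (∫ ω, ‖u ω - xs ω‖ ^ 2 ∂P
        + ∫ ω, ‖empiricalGrad f (S ω) y‖ ^ 2 ∂P) := by
  have := R.prob
  have hμ := R.mu_pos
  have hL := R.L_pos
  have hi := R.integrable_empiricalLoss hint
  have hig := R.integrable_inner_empiricalGrad y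
  -- The empirical inequality is integrated at a fixed `v`, which removes the linear term by the
  -- choice of `y`. The result is deterministic and may then be evaluated at the data-dependent `u
  -- ω`.
  have hup : ∀ v, populationLoss f D v ≤ populationLoss f D y + L * ‖v - y‖ ^ 2 := fun v => by
    have h := integral_mono (hi v) (((hi y).add (hig (v - y))).add (integrable_const _)) fun ω =>
      R.convex.empiricalLoss_le R.smooth hμ.le R.N_pos R.Z_pos (S ω) v y
    rw [integral_add' ((hi y).add (hig (v - y))) (integrable_const _),
      integral_add' (hi y) (hig (v - y)), R.integral_inner_empiricalGrad, hy, inner_zero_left,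
      ← R.populationLoss_eq hint, ← R.populationLoss_eq hint] at h
    simpa using h
  have hlow : ∀ v, populationLoss f D y ≤ populationLoss f D v := fun v => by
    have h := integral_mono ((hi y).add (hig (v - y))) (hi v) fun ω =>
      R.convex.le_empiricalLoss hμ.le (S ω) v y
    rw [integral_add' (hi y) (hig (v - y)), R.integral_inner_empiricalGrad, hy, inner_zero_left,
      ← R.populationLoss_eq hint, ← R.populationLoss_eq hint] at h
    simpa using h
  have huy2 : MemLp (fun ω => u ω - y) 2 P :=
    (hu2.sub (R.memLp_const_sub y)).ae_eq (Filter.Eventually.of_forall fun ω => by simp)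
  have hg2 := R.memLp_empiricalGrad_const y
  have hinner := hg2.integrable_inner_two huy2
  have hFu : Integrable (fun ω => populationLoss f D (u ω)) P := by
    refine ((integrable_const |populationLoss f D y|).add
      (huy2.integrable_norm_sq.const_mul L)).mono'
      (R.measurable_populationLoss.comp hu).aestronglyMeasurable
      (Filter.Eventually.of_forall fun ω => ?_)
    simp only [Pi.add_apply, Real.norm_eq_abs]
    have h1 := hup (u ω)
    have h2 := hlow (u ω)
    have h3 : 0 ≤ L * ‖u ω - y‖ ^ 2 := by positivity
    rw [abs_le]
    constructor <;> linarith [neg_abs_le (populationLoss f D y), le_abs_self (populationLoss f D y)]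
  have hFSu : Integrable (fun ω => empiricalLoss f (S ω) (u ω)) P := by
    refine (((hi y).abs.add hinner.abs).add (huy2.integrable_norm_sq.const_mul L)).mono'
      (R.measurable_empiricalLoss_comp hu).aestronglyMeasurable
      (Filter.Eventually.of_forall fun ω => ?_)
    simp only [Pi.add_apply, Real.norm_eq_abs]
    have h1 := R.convex.empiricalLoss_le R.smooth hμ.le R.N_pos R.Z_pos (S ω) (u ω) y
    have h2 := R.convex.le_empiricalLoss hμ.le (S ω) (u ω) y
    have h3 : 0 ≤ L * ‖u ω - y‖ ^ 2 := by positivity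
    have h4 := abs_le.1 (le_refl |empiricalLoss f (S ω) y|)
    have h5 := abs_le.1 (le_refl |inner ℝ (empiricalGrad f (S ω) y) (u ω - y)|)
    rw [abs_le]
    constructor <;> linarith
  refine ⟨hFu.sub hFSu, ?_⟩
  -- The first summand on the right does not involve `u` and has mean zero. The dependence of `u` on
  -- the data enters only through quadratic terms.
  have hpt : ∀ ω, populationLoss f D (u ω) - empiricalLoss f (S ω) (u ω)
      ≤ (populationLoss f D y - empiricalLoss f (S ω) y)
        + (2 * L + 1) * (1 + 1 / μ ^ 2)
          * (‖u ω - xs ω‖ ^ 2 + ‖empiricalGrad f (S ω) y‖ ^ 2) := fun ω => by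
    have h1 := hup (u ω)
    have h2 := R.convex.le_empiricalLoss hμ.le (S ω) (u ω) y
    have h3 := neg_le_of_abs_le (abs_real_inner_le_norm (empiricalGrad f (S ω) y) (u ω - y))
    have h4 : ‖empiricalGrad f (S ω) y‖ * ‖u ω - y‖
        ≤ ‖empiricalGrad f (S ω) y‖ ^ 2 / 2 + ‖u ω - y‖ ^ 2 / 2 := by
      nlinarith [sq_nonneg (‖empiricalGrad f (S ω) y‖ - ‖u ω - y‖)]
    have h5 := norm_add_sq_le_two (u ω - xs ω) (xs ω - y)
    rw [sub_add_sub_cancel] at h5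
    have h6 : ‖xs ω - y‖ ^ 2 ≤ 1 / μ ^ 2 * ‖empiricalGrad f (S ω) y‖ ^ 2 := by
      have a := (R.convex.regularMap_empiricalGrad R.smooth R.N_pos R.Z_pos (S ω)).norm_sub_zero_le
        (x := y) (R.xs_zero ω)
      rw [norm_sub_rev] at a
      have b := pow_le_pow_left₀ (by positivity) a 2
      rw [one_div_mul_eq_div, le_div_iff₀ (by positivity)]
      linarith
    have h7 : (L + 1 / 2) * ‖u ω - y‖ ^ 2 ≤ (L + 1 / 2) * (2 * ‖u ω - xs ω‖ ^ 2
        + 2 * (1 / μ ^ 2 * ‖empiricalGrad f (S ω) y‖ ^ 2)) := by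
      gcongr; linarith
    have h8 : 0 ≤ 1 / μ ^ 2 * ‖u ω - xs ω‖ ^ 2 * (2 * L + 1) := by positivity
    have h9 : 0 ≤ 2 * L * ‖empiricalGrad f (S ω) y‖ ^ 2 := by positivity
    nlinarith [sq_nonneg ‖empiricalGrad f (S ω) y‖]
  have hi1 : Integrable (fun ω => populationLoss f D y - empiricalLoss f (S ω) y) P :=
    (integrable_const _).sub (hi y)
  have hi2 := (hu2.integrable_norm_sq.add hg2.integrable_norm_sq).const_mul
    ((2 * L + 1) * (1 + 1 / μ ^ 2))
  refine (integral_mono (hFu.sub hFSu) (hi1.add hi2) hpt).trans_eq ?_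
  rw [integral_add' hi1 hi2, integral_sub (integrable_const _) (hi y), ← R.populationLoss_eq hint,
    integral_const_mul, integral_add' hu2.integrable_norm_sq hg2.integrable_norm_sq]
  simp

/-- The empirical gradient at the population minimizer is small. -/
lemma integral_empiricalGrad_sq_le_div
    (R : IsDsgdRun f G A W μ L lam ρ α x₀ P 𝓕 D S idx byz σ δ xs x) {y : Model d}
    (hy : ∫ ω, empiricalGrad f (S ω) y ∂P = 0) :
    ∫ ω, ‖empiricalGrad f (S ω) y‖ ^ 2 ∂P
      ≤ (2 * (σ ^ 2 + δ ^ 2) + 2 * L ^ 2 * (L ^ 2 / μ ^ 2 + 1) * ∫ ω, ‖x₀ - xs ω‖ ^ 2 ∂P)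
        / (N * Z) := by
  have h1 := R.integral_empiricalGrad_sq_le hy
  have h2 := R.integral_empiricalGrad_sq_le_init hy
  have h0 : 0 ≤ ∫ ω, ‖empiricalGrad f (S ω) y‖ ^ 2 ∂P := integral_nonneg fun ω => by positivity
  have hR : 0 ≤ 2 * L ^ 2 * (L ^ 2 / μ ^ 2 + 1) * ∫ ω, ‖x₀ - xs ω‖ ^ 2 ∂P :=
    mul_nonneg (by positivity) (integral_nonneg fun ω => by positivity)
  have hNZ : 0 < N * Z := Nat.mul_pos R.N_pos R.Z_pos
  have hNZ' : (0 : ℝ) < N * Z := by exact_mod_cast hNZ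
  rw [le_div_iff₀ hNZ']
  -- For N Z ≥ 2 one has N Z ≤ 2(N Z - 1). For a single sample the independence bound is void and
  -- the initial distance is used.
  rcases Nat.lt_or_ge 1 (N * Z) with h | h
  · have h' : (2 : ℝ) ≤ N * Z := by exact_mod_cast h
    nlinarith
  · have h' : (N : ℝ) * Z = 1 := by exact_mod_cast le_antisymm h hNZ
    rw [h']
    nlinarith [sq_nonneg σ, sq_nonneg δ]

end IsDsgdRun

/-! ### The main theorem. -/

/-- The order of quantifiers encodes uniformity: `K` depends on μ, L, λ alone, and `C` is fixed
before the network, the data and the adversary. The bound λ ≤ 1 is automatic, by `mixingGap_le_one`.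
-/
theorem theorem6 (μ L lam : ℝ) (hμ : 0 < μ) (hL : 0 < L) (hlam : 0 < lam) :
    ∃ K : ℝ, 0 < K ∧ ∀ k₁ : ℝ, K ≤ k₁ →
    ∀ a b : ℝ, 0 < a → a ≤ b →
    ∃ C : ℝ, 0 < C ∧
    ∀ (N B Z d : ℕ), 0 < N → 0 < Z →
    -- the network and the robust aggregation rules
    ∀ (G : SimpleGraph (Fin N ⊕ Fin B)), G.Connected → (G.comap Sum.inl).Connected →
    ∀ (A : (n : Fin N) → AggregationRule G d n),
    (∀ n, Measurable (fun p : Model d × (G.neighborSet (Sum.inl n) → Model d) => A n p.1 p.2)) →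
    ∀ (W : Matrix (Fin N) (Fin N) ℝ) (ρ : ℝ), IsVirtualMixing G A W ρ →
    mixingGap W = lam → ρ < lam / (8 * √(N : ℝ)) →
    -- the loss, the data distributions, the random dataset, draws and Byzantine messages
    ∀ (Ξ : Type*) [MeasurableSpace Ξ] (f : Model d → Ξ → ℝ) (D : Fin N → Measure Ξ)
      (Ω : Type*) (mΩ : MeasurableSpace Ω) (P : Measure Ω) (𝓕 : Filtration ℕ mΩ)
      (S : Ω → Fin N → Fin Z → Ξ) (idx : ℕ → Ω → Fin N → Fin Z)
      (byz : ℕ → Fin B → Fin N → Ω → Model d),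
    IsProbabilityMeasure P → IsByzantineSetup P 𝓕 D S idx byz →
    (∀ x, Measurable (f x)) → (∀ x n, Integrable (f x) (D n)) →
    StronglyConvexLoss f μ → SmoothLoss f L →
    ∀ (σ δ : ℝ), 0 ≤ σ → 0 ≤ δ →
    (∀ᵐ ω ∂P, BoundedNoise f (S ω) σ) → (∀ᵐ ω ∂P, BoundedHeterogeneity f (S ω) δ) →
    -- the initial model, the iterates and the minimizer of the empirical loss
    ∀ (x₀ : Model d) (x : ℕ → Ω → Fin N → Model d),
    x = dsgd f G A (fun k => 2 / (μ * (k + k₁))) x₀ S idx byz →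
    ∀ (xS : Ω → Model d), (∀ᵐ ω ∂P, ∀ y, empiricalLoss f (S ω) (xS ω) ≤ empiricalLoss f (S ω) y) →
    MemLp (fun ω => meanModel (x 0 ω) - xS ω) 2 P →
    ∀ k : ℕ, a * (μ * N * Z) ≤ k → k ≤ b * (μ * N * Z) →
      Integrable (fun ω => populationLoss f D (meanModel (x k ω))
        - empiricalLoss f (S ω) (meanModel (x k ω))) P ∧
      ∫ ω, (populationLoss f D (meanModel (x k ω))
          - empiricalLoss f (S ω) (meanModel (x k ω))) ∂P ≤
        C * ((∫ ω, ‖meanModel (x 0 ω) - xS ω‖ ^ 2 ∂P) / (μ * N * Z)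
          + σ ^ 2 * (1 + Real.log (N * Z)) / (μ * N * Z)
          + δ ^ 2 / (μ * N * Z)
          + (4 * ρ ^ 2 * N + chiSq W) * (σ ^ 2 + δ ^ 2)) := by
  refine ⟨shiftThreshold μ L lam, by unfold shiftThreshold; positivity, fun k₁ hk₁ a b ha _ => ?_⟩
  have hr := rateConst_pos (L := L) hμ hlam
  have hk₁0 : 0 < k₁ := lt_of_lt_of_le (by unfold shiftThreshold; positivity) hk₁
  set r := rateConst μ L lam
  set c := 2 * L ^ 2 * (L ^ 2 / μ ^ 2 + 1) with hc
  set q := (2 * L + 1) * (1 + 1 / μ ^ 2) with hq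
  have hc0 : 0 < c := by positivity
  have hq0 : 0 < q := by positivity
  -- `q` is the factor from the generalization bound; the bracket adds up the coefficients of the
  -- initial, variance and floor terms in the optimization and statistical bounds.
  refine ⟨q * (k₁ / a + μ * c + r / a + 2 * μ + r), by positivity, ?_⟩
  intro N B Z d hN hZ G _ _ A hAm W ρ hA hgap hρ Ξ _ f D Ω mΩ P 𝓕 S idx byz hP hset hfm hint hf hs
    σ δ _ _ hσ hδ x₀ x hx xS hxS hxS2 k hk _
  -- The given minimizer is specified only almost surely. It is replaced by an `𝓕 0`-measurable one,
  -- equal to it almost surely by uniqueness, so that the draws are independent of it.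
  obtain ⟨xs, hxsm, hxs0⟩ := @exists_measurable_zero d μ L hμ Ω (𝓕 0)
    (fun ω => empiricalGrad f (S ω)) (fun ω => hf.regularMap_empiricalGrad hs hN hZ (S ω))
    fun u => (Finset.measurable_sum _ fun n _ => (Finset.measurable_sum _ fun z _ =>
      (hf.measurable_lossGrad hfm u).comp (hset.data_meas n z)).const_smul (1 / (Z : ℝ))).const_smul
        (1 / (N : ℝ))
  have hae : ∀ᵐ ω ∂P, xS ω = xs ω := by
    filter_upwards [hxS] with ω hω
    exact (hf.regularMap_empiricalGrad hs hN hZ (S ω)).zero_unique hμ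
      (hf.empiricalGrad_eq_zero hω) (hxs0 ω)
  have hmean : ∀ ω, meanModel (x 0 ω) = x₀ := fun ω => by
    have e : x 0 ω = fun _ => x₀ := by rw [hx]; rfl
    rw [e, meanModel_const hN]
  have R : IsDsgdRun f G A W μ L lam ρ (fun k => 2 / (μ * (k + k₁))) x₀ P 𝓕 D S idx byz σ δ xs x :=
    { N_pos := hN, Z_pos := hZ, mu_pos := hμ, L_pos := hL, lam_pos := hlam, agg_meas := hAm
      mixing := hA, gap := hgap, rho_lt := hρ, prob := hP, setup := hset, loss_meas := hfm
      convex := hf, smooth := hs, noise := hσ, het := hδ, xs_meas := hxsm, xs_zero := hxs0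
      memLp_init := hxS2.ae_eq (by
        filter_upwards [hae] with ω hω
        rw [hmean, hω])
      x_eq := hx }
  obtain ⟨y, hy⟩ := R.exists_integral_empiricalGrad_eq_zero
  obtain ⟨hI, hE⟩ := R.generalizationError_le hint hy
    ((R.measurable_meanModel_x k).mono (𝓕.le k) le_rfl) (R.memLp_meanModel_x k)
  refine ⟨hI, hE.trans ?_⟩
  have hR0 : ∫ ω, ‖meanModel (x 0 ω) - xS ω‖ ^ 2 ∂P = ∫ ω, ‖x₀ - xs ω‖ ^ 2 ∂P :=
    integral_congr_ae (by
      filter_upwards [hae] with ω hω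
      rw [hmean, hω])
  have hrate := R.integral_meanModel_rate hk₁ k
  have hgrad := R.integral_empiricalGrad_sq_le_div hy
  simp only [hmean] at hrate
  rw [hR0]
  have hR0n : 0 ≤ ∫ ω, ‖x₀ - xs ω‖ ^ 2 ∂P := integral_nonneg fun ω => by positivity
  generalize (∫ ω, ‖x₀ - xs ω‖ ^ 2 ∂P) = R₀ at *
  have hΨ : 0 ≤ 4 * ρ ^ 2 * N + chiSq W := add_nonneg (by positivity) (chiSq_nonneg W)
  generalize 4 * ρ ^ 2 * N + chiSq W = Ψ at *
  have hN' : (0 : ℝ) < N := by exact_mod_cast hN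
  have hZ' : (0 : ℝ) < Z := by exact_mod_cast hZ
  have hlog : 0 ≤ Real.log (N * Z) := Real.log_nonneg (by exact_mod_cast Nat.mul_pos hN hZ)
  have hV : 0 ≤ σ ^ 2 + δ ^ 2 := by positivity
  have hμN : 0 < μ * N * Z := by positivity
  -- The lower bound on k converts the decay in k into decay in μNZ.
  have h1 : (k₁ * R₀ + r * (σ ^ 2 + δ ^ 2)) / (k + k₁)
      ≤ k₁ / a * (R₀ / (μ * N * Z)) + r / a * ((σ ^ 2 + δ ^ 2) / (μ * N * Z)) := by
    calc _ ≤ (k₁ * R₀ + r * (σ ^ 2 + δ ^ 2)) / (a * (μ * N * Z)) := by gcongr; linarith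
      _ = _ := by field_simp
  have h2 : (2 * (σ ^ 2 + δ ^ 2) + c * R₀) / (N * Z)
      = 2 * μ * ((σ ^ 2 + δ ^ 2) / (μ * N * Z)) + μ * c * (R₀ / (μ * N * Z)) := by
    field_simp
  rw [h2] at hgrad
  have h3 : (σ ^ 2 + δ ^ 2) / (μ * N * Z)
      ≤ σ ^ 2 * (1 + Real.log (N * Z)) / (μ * N * Z) + δ ^ 2 / (μ * N * Z) := by
    rw [← add_div]
    gcongr
    nlinarith [mul_nonneg (sq_nonneg σ) hlog]
  have h4 : 0 ≤ R₀ / (μ * N * Z) := by positivity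
  have h5 : 0 ≤ (σ ^ 2 + δ ^ 2) / (μ * N * Z) := by positivity
  have h6 : 0 ≤ Ψ * (σ ^ 2 + δ ^ 2) := by positivity
  rw [mul_assoc q]
  refine mul_le_mul_of_nonneg_left ?_ hq0.le
  generalize R₀ / (μ * N * Z) = t₁ at *
  generalize (σ ^ 2 + δ ^ 2) / (μ * N * Z) = t₂ at *
  generalize Ψ * (σ ^ 2 + δ ^ 2) = t₃ at *
  have hka : 0 < k₁ / a := by positivity
  have hra : 0 < r / a := by positivity
  have hμc : 0 < μ * c := by positivity
  calc _ ≤ k₁ / a * t₁ + r / a * t₂ + r * t₃ + (2 * μ * t₂ + μ * c * t₁) := by linarith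
    _ ≤ (k₁ / a + μ * c + r / a + 2 * μ + r) * (t₁ + t₂ + t₃) := by
      have e : (k₁ / a + μ * c + r / a + 2 * μ + r) * (t₁ + t₂ + t₃)
          - (k₁ / a * t₁ + r / a * t₂ + r * t₃ + (2 * μ * t₂ + μ * c * t₁))
          = (r / a + 2 * μ + r) * t₁ + (k₁ / a + μ * c + r) * t₂
            + (k₁ / a + μ * c + r / a + 2 * μ) * t₃ := by ring
      have : 0 ≤ (r / a + 2 * μ + r) * t₁ + (k₁ / a + μ * c + r) * t₂
            + (k₁ / a + μ * c + r / a + 2 * μ) * t₃ := by positivity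
      linarith
    _ ≤ _ := by
      refine mul_le_mul_of_nonneg_left ?_ (by positivity)
      linarith
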